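/- Let $\mathbb{F}_q$ be a finite field of characteristic $2$ with $q=2^d$ elements, $q\neq 2$. Let $(\mathbb{T},\mathfrak{m})$ be a finite-dimensional local commutative $\mathbb{F}_q$-algebra with the discrete topology, with residue field $\mathbb{T}/\mathfrak{m}=\mathbb{F}_q$ and with $\mathfrak{m}^2=0$. For a subgroup $D\subseteq\mathbb{F}_q^\times$ and a commutative $\mathbb{F}_q$-algebra $R$ write $\mathrm{GL}_2^D(R)=\{g\in\mathrm{GL}_2(R):\det g\in D\}$ ($D$ being mapped to $R^\times$), and write $\mathrm{M}_2^0(I)$ for the trace-zero $2\times2$ matrices with entries in an ideal $I$ of $R$; $\mathrm{GL}_2^D(\mathbb{F}_q)$ acts on matrices over $R$ by conjugation. Let $C_2\subseteq\mathrm{M}_2^0(\mathbb{F}_q)$ be a subgroup of order $2$ of the scalar matrices (with its trivial conjugation action). Let $G_\mathbb{Q}=\mathrm{Gal}(\overline{\mathbb{Q}}/\mathbb{Q})$, let $N\geq1$ be an integer and let $\rho:G_{\mathbb{Q}}\to\mathrm{GL}_2(\mathbb{T})$ be a continuous representation, unramified at all primes $\ell\nmid 2N$, with reduction $\overline\rho:G_\mathbb{Q}\to\mathrm{GL}_2(\mathbb{F}_q)$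 modulo $\mathfrak{m}$, such that for some subgroup $D\subseteq\mathbb{F}_q^\times$ (necessarily $D=\mathrm{Im}(\det\circ\overline\rho)$): (a) $\mathrm{Im}(\overline\rho)=\mathrm{GL}_2^D(\mathbb{F}_q)$; (b) $\mathrm{Im}(\rho)\subseteq\mathrm{GL}_2^D(\mathbb{T})$; (c) $\mathbb{T}$ is generated as an $\mathbb{F}_q$-algebra by the traces of the elements of $\mathrm{Im}(\rho)$. Let $m=\dim_{\mathbb{F}_q}\mathfrak{m}$ and let $t$ be the number of different traces of elements of $\mathrm{Im}(\rho)$. Then there are integers $0\leq\alpha\leq m$ and $0\leq\beta\leq d(m-\alpha)$ with $t=q^\alpha\bigl((q-1)2^\beta+1\bigr)$, and there are number fields $L/K/\mathbb{Q}$ inside $\overline{\mathbb{Q}}$, Galois over $\mathbb{Q}$, with $G_L=\ker\rho$ and $G_K=\ker\overline\rho$, such that the following hold. 1. $\overline\rho$ induces an isomorphism $\mathrm{Gal}(K/\mathbb{Q})\cong\mathrm{GL}_2^D(\mathbb{F}_q)$, through which $\mathrm{Gal}(K/\mathbb{Q})$ acts on all the modules below. 2. There is an $\mathbb{F}_2[\mathrm{GL}_2^D(\mathbb{F}_q)]$-submodule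 $M\subseteq\mathrm{M}_2^0(\mathfrak{m})$, isomorphic as a module to $\mathrm{M}_2^0(\mathbb{F}_q)^\alpha\oplus C_2^\beta$, with $\mathrm{Gal}(L/\mathbb{Q})\cong M\rtimes\mathrm{Gal}(K/\mathbb{Q})$ compatibly with the projections to $\mathrm{Gal}(K/\mathbb{Q})$; and $\mathrm{Gal}(L/K)$, on which $\mathrm{Gal}(K/\mathbb{Q})$ acts by conjugation through preimages in $\mathrm{Gal}(L/\mathbb{Q})$, is isomorphic to the module $M$. 3. $L/K$ is an abelian extension of degree $2^{3d\alpha+\beta}$ which is unramified at all primes of $L$ lying above primes $\ell\nmid2N$. 4. If $\alpha\neq0$, there are extensions $L_1,L_2$ of $K$ inside $\overline{\mathbb{Q}}$, both Galois over $\mathbb{Q}$, with $L=L_1L_2$, with $\mathrm{Gal}(L_1/K)\cong\mathrm{M}_2^0(\mathbb{F}_q)^\alpha$ and $\mathrm{Gal}(L_2/K)\cong C_2^\beta$ (compatibly with the actions of $\mathrm{Gal}(K/\mathbb{Q})$, by conjugation on the left-hand sides), and such that $L_1/K$ cannot be defined over $\mathbb{Q}$, that is, there is no Galois extension $E/\mathbb{Q}$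 with $E\cap K=\mathbb{Q}$ and $L_1=EK$. -/

import Mathlib

open scoped NumberField Matrix

/-- `GL_2^D(R)` for a field `k`, a subgroup `D ⊆ kˣ` and a commutative `k`-algebra `R`: the
invertible `2 × 2` matrices over `R` whose determinant lies in (the image in `R` of) `D`.
For `R = k` this is `{g ∈ GL_2(k) : det g ∈ D}`. -/
def GLTwoDet {k : Type*} [Field k] (D : Subgroup kˣ) (R : Type*) [CommRing R] [Algebra k R] :
    Subgroup (GL (Fin 2) R) :=
  (D.map (Units.map (algebraMap k R).toMonoidHom)).comap Matrix.GeneralLinearGroup.det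

/-- The `ℤ[GL_2^D(k)]`-submodules of the matrix algebra `M_2(R)`, where `R` is a commutative
`k`-algebra and `GL_2^D(k)` acts by conjugation.
If `k` has characteristic `2`, then `M_2(R)` is killed by `2`, so that these are exactly the
`𝔽_2[GL_2^D(k)]`-submodules of `M_2(R)`. -/
structure ConjSubmodule {k : Type*} [Field k] (D : Subgroup kˣ) (R : Type*) [CommRing R]
    [Algebra k R] where
  /-- the underlying additive group of matrices -/
  toAddSubgroup : AddSubgroup (Matrix (Fin 2) (Fin 2) R)
  conj_mem : ∀ g ∈ GLTwoDet D k, ∀ A ∈ toAddSubgroup,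
    (algebraMap k R).mapMatrix (g : Matrix (Fin 2) (Fin 2) k) * A *
      (algebraMap k R).mapMatrix ((g⁻¹ : GL (Fin 2) k) : Matrix (Fin 2) (Fin 2) k) ∈ toAddSubgroup

namespace ConjSubmodule

variable {k : Type*} [Field k] {D : Subgroup kˣ} {R : Type*} [CommRing R] [Algebra k R]

/-- The elements of a submodule, as a type. -/
def Elem (M : ConjSubmodule D R) : Type _ := M.toAddSubgroup

instance (M : ConjSubmodule D R) : AddCommGroup M.Elem :=
  inferInstanceAs (AddCommGroup M.toAddSubgroup)

/-- The action of `GL_2^D(k)` by conjugation, `g • A = g A g⁻¹`. -/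
instance (M : ConjSubmodule D R) : DistribMulAction (GLTwoDet D k) M.Elem where
  smul g A := ⟨_, M.conj_mem g.1 g.2 A.1 A.2⟩
  one_smul A := Subtype.ext <| by
    change (algebraMap k R).mapMatrix ((1 : GL (Fin 2) k) : Matrix (Fin 2) (Fin 2) k) * A.1 *
      (algebraMap k R).mapMatrix (((1 : GL (Fin 2) k)⁻¹ : GL (Fin 2) k) :
        Matrix (Fin 2) (Fin 2) k) = A.1
    rw [inv_one, Units.val_one, map_one, one_mul, mul_one]
  mul_smul g h A := Subtype.ext <| by
    change (algebraMap k R).mapMatrix ((g.1 * h.1 : GL (Fin 2) k) : Matrix (Fin 2) (Fin 2) k) *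
        A.1 * (algebraMap k R).mapMatrix (((g.1 * h.1)⁻¹ : GL (Fin 2) k) :
          Matrix (Fin 2) (Fin 2) k) =
      (algebraMap k R).mapMatrix (g.1 : Matrix (Fin 2) (Fin 2) k) *
        ((algebraMap k R).mapMatrix (h.1 : Matrix (Fin 2) (Fin 2) k) * A.1 *
          (algebraMap k R).mapMatrix ((h.1⁻¹ : GL (Fin 2) k) : Matrix (Fin 2) (Fin 2) k)) *
        (algebraMap k R).mapMatrix ((g.1⁻¹ : GL (Fin 2) k) : Matrix (Fin 2) (Fin 2) k)
    rw [mul_inv_rev, Units.val_mul, Units.val_mul, map_mul, map_mul]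
    simp only [mul_assoc]
  smul_zero g := Subtype.ext <| by
    change _ * (0 : Matrix (Fin 2) (Fin 2) R) * _ = 0
    rw [mul_zero, zero_mul]
  smul_add g A B := Subtype.ext <| by
    change _ * (A.1 + B.1) * _ = _ * A.1 * _ + _ * B.1 * _
    rw [mul_add, add_mul]

/-- `M_2^0(I)`: the trace-zero matrices all of whose entries lie in the ideal `I` of `R`. -/
def traceZero (D : Subgroup kˣ) {R : Type*} [CommRing R] [Algebra k R] (I : Ideal R) :
    ConjSubmodule D R where
  toAddSubgroup :=
    { carrier := {A | A.trace = 0 ∧ ∀ i j, A i j ∈ I}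
      zero_mem' := ⟨Matrix.trace_zero _ _, fun _ _ => I.zero_mem⟩
      add_mem' := fun {A B} hA hB =>
        ⟨by rw [Matrix.trace_add, hA.1, hB.1, add_zero],
          fun i j => I.add_mem (hA.2 i j) (hB.2 i j)⟩
      neg_mem' := fun {A} hA =>
        ⟨by rw [Matrix.trace_neg, hA.1, neg_zero], fun i j => I.neg_mem (hA.2 i j)⟩ }
  conj_mem := by
    rintro g - A ⟨htr, hI⟩
    refine ⟨?_, fun i j => ?_⟩
    · rw [Matrix.trace_mul_comm, ← mul_assoc, ← map_mul, Units.inv_mul, map_one, one_mul, htr]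
    · rw [Matrix.mul_apply]
      refine I.sum_mem fun l _ => I.mul_mem_right _ ?_
      rw [Matrix.mul_apply]
      exact I.sum_mem fun n _ => I.mul_mem_left _ (hI n l)

/-- The additive group `{0, Id, 2 Id, …}` generated by the identity matrix of `M_2(k)`. In
characteristic `2` it is the group `C_2 = {0, Id}` of order two of scalar matrices; as scalar
matrices are fixed by conjugation, all groups of order two of scalar matrices are isomorphic to
it as modules. -/
def scalarCyclic (D : Subgroup kˣ) : ConjSubmodule D k where
  toAddSubgroup := AddSubgroup.zmultiples 1
  conj_mem := by
    rintro g - A hA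
    obtain ⟨n, rfl⟩ := AddSubgroup.mem_zmultiples_iff.mp hA
    rw [mul_smul_comm, mul_one, smul_mul_assoc, ← map_mul, Units.mul_inv, map_one]
    exact hA

end ConjSubmodule

/-- `M_2^0(k)` as a `GL_2^D(k)`-module. -/
abbrev TraceZero {k : Type*} [Field k] (D : Subgroup kˣ) : Type _ :=
  (ConjSubmodule.traceZero D (⊤ : Ideal k)).Elem

/-- `C_2 = {0, Id}` (when `k` has characteristic `2`) as a `GL_2^D(k)`-module. -/
abbrev ScalarCTwo {k : Type*} [Field k] (D : Subgroup kˣ) : Type _ :=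
  (ConjSubmodule.scalarCyclic D).Elem

/-- The homomorphism `H → Aut(A)` (with `A` written multiplicatively) given by a homomorphism
`e : H → G` and an action of `G` on the additive group `A`. -/
def actionHom {H G : Type*} [Group H] [Group G] (e : H →* G) (A : Type*) [AddCommGroup A]
    [DistribMulAction G A] : H →* MulAut (Multiplicative A) :=
  ((MulAutMultiplicative A).symm.toMonoidHom.comp (DistribMulAction.toAddAut G A)).comp e

/-- A representation `ρ` of the absolute Galois group of `ℚ` is unramified at `ℓ`: for every
prime `𝔓` of the ring of algebraic integers containing `ℓ`, the inertia group
`{σ : σ x ≡ x mod 𝔓 for all x}` is contained in `ker ρ`. -/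
def IsUnramifiedRepAt {G : Type*} [Group G]
    (ρ : Gal(AlgebraicClosure ℚ/ℚ) →* G) (ℓ : ℕ) : Prop :=
  ∀ 𝔓 : Ideal (𝓞 (AlgebraicClosure ℚ)), 𝔓.IsPrime → (ℓ : 𝓞 (AlgebraicClosure ℚ)) ∈ 𝔓 →
    𝔓.inertia Gal(AlgebraicClosure ℚ/ℚ) ≤ ρ.ker

/-- `L/K` is unramified at all primes of `L` above `ℓ`. -/
def IsUnramifiedExtAt (K L : Type*) [Field K] [Field L] [Algebra K L] (ℓ : ℕ) : Prop :=
  ∀ (P : Ideal (𝓞 L)) [P.IsPrime], (ℓ : 𝓞 L) ∈ P → Algebra.IsUnramifiedAt (𝓞 K) P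

section Fields

variable {Ω : Type*} [Field Ω] [Algebra ℚ Ω] {K : IntermediateField ℚ Ω}

/-- A Galois extension `F/K` can be defined over `ℚ`: there is a Galois extension `E/ℚ` with
`E ∩ K = ℚ` and `F = E K` (so that restriction is an isomorphism `Gal(F/K) ≅ Gal(E/ℚ)`). -/
def IsDefinableOverRat (F : IntermediateField K Ω) : Prop :=
  ∃ E : IntermediateField ℚ Ω, IsGalois ℚ E ∧ E ⊓ K = ⊥ ∧ E ⊔ K = F.restrictScalars ℚ

/-- `κ ∈ Gal(K/ℚ)` is the restriction to `K` of `τ ∈ Gal(F/ℚ)`. -/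
def RestrictsTo (F : IntermediateField K Ω) (τ : Gal(F/ℚ)) (κ : Gal(K/ℚ)) : Prop :=
  ∀ x : K, τ (algebraMap K F x) = algebraMap K F (κ x)

/-- Given `e : Gal(K/ℚ) → G`, the group `Gal(F/K)`, on which `Gal(K/ℚ)` acts by conjugation
through preimages in `Gal(F/ℚ)`, is isomorphic to the `G`-module `A`: there is an isomorphism of
groups `ι : Gal(F/K) ≅ A` such that `ι(τ s τ⁻¹) = e(τ|_K) • ι(s)`
for all `τ ∈ Gal(F/ℚ)` and `s ∈ Gal(F/K)`. -/
def GaloisModuleIso {G : Type*} [Group G] (e : Gal(K/ℚ) →* G) (F : IntermediateField K Ω)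
    (A : Type*) [AddCommGroup A] [DistribMulAction G A] : Prop :=
  ∃ ι : Gal(F/K) ≃* Multiplicative A,
    ∀ (τ : Gal(F/ℚ)) (κ : Gal(K/ℚ)) (s s' : Gal(F/K)), RestrictsTo F τ κ →
      s'.restrictScalars ℚ = τ * s.restrictScalars ℚ * τ⁻¹ →
      (ι s').toAdd = e κ • (ι s).toAdd

end Fields

/-! ### Subgroups of GL_2(T) with full image modulo the maximal ideal -/

section FullReduction

variable {k T : Type*} [Field k] [CommRing T] [Algebra k T]

/-! Let 𝔪 be the maximal ideal, π : T → k the retraction with kernel 𝔪, and G the image of ρ. Since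
𝔪² = 0, the map A ↦ 1 + A turns addition on M_2(𝔪) into multiplication, and det(1 + A) = 1 + tr A.
As determinants in G are constants from D, the A ∈ M_2(𝔪) with 1 + A ∈ G form a conjugation-stable
subgroup M of M_2^0(𝔪).

The group-theoretic core is that, after conjugation by a matrix congruent to 1, G contains GL_2^D(k)
(`exists_conj_contains`), so that G = (1 + M) · GL_2^D(k). Lifts of a torus generator, of a
unipotent and of the Weyl element are straightened one after another. Error terms are conjugated
away or shown to lie in M, and leftover scalars 1 + x disappear because (1 + x)² = 1.

In characteristic 2 the module M_2^0(k) contains the scalars, so submodules of M_2^0(𝔪) need not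
come from subspaces of 𝔪. For q > 2 such a submodule is determined by the k-space W of its
off-diagonal entries and the additive group S ⊇ W of its scalars (`fin_two_mem_iff`). Hence M ≅
M_2^0(k)^α ⊕ C_2^β with α = dim_k W and β = dim_{𝔽_2} S/W (`exists_equiv`). The traces of (1 + A)γ
fill W and the set of λ(1 + x) with λ ∈ kˣ, x ∈ S; this gives the formula for t (`ncard_traces`).

On the Galois side, ρ(σ) = (1 + a(σ)) ρbar(σ) up to conjugation, with a an M-valued cocycle
(`exists_cocycle`). It yields the semidirect product and the module Gal(L/K), and its two components
cut out L₁ and L₂. If L₁ came from some E over ℚ, then Gal(K/ℚ) would act trivially on Gal(L₁/K),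
which is false for α ≠ 0. For ramification, inertia elements of Gal(L/K) are lifted to the absolute
Galois group (`exists_inertia_lift`). -/

theorem mem_GLTwoDet_self {D : Subgroup kˣ} {g : GL (Fin 2) k} :
    g ∈ GLTwoDet D k ↔ Matrix.GeneralLinearGroup.det g ∈ D := by
  have : Units.map (algebraMap k k).toMonoidHom = MonoidHom.id kˣ := by ext; rfl
  rw [GLTwoDet, Subgroup.mem_comap, this, Subgroup.map_id]

theorem Matrix.fin_two_congr {R : Type*} {a b c d a' b' c' d' : R} (h₁ : a = a') (h₂ : b = b')
    (h₃ : c = c') (h₄ : d = d') : !![a, b; c, d] = !![a', b'; c', d'] := by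
  rw [h₁, h₂, h₃, h₄]

variable (k) in
theorem two_eq_zero_of_algebra [CharP k 2] : (2 : T) = 0 := by
  rw [← map_ofNat (algebraMap k T) 2, CharTwo.two_eq_zero, map_zero]

/-- The subgroup `G` of `GL_2^D(T)` maps onto `GL_2^D(k)` under `π : T → k`. -/
structure HasFullReduction (π : T →ₐ[k] k) (D : Subgroup kˣ) (G : Subgroup (GL (Fin 2) T)) :
    Prop where
  map_eq : G.map (Matrix.GeneralLinearGroup.map (π : T →+* k)) = GLTwoDet D k
  le : G ≤ GLTwoDet D T

/-- The matrices underlying the elements of a subgroup of `GL_2(T)`. -/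
def matricesOf (G : Subgroup (GL (Fin 2) T)) : Submonoid (Matrix (Fin 2) (Fin 2) T) :=
  G.toSubmonoid.map (Units.coeHom _)

theorem mem_matricesOf {G : Subgroup (GL (Fin 2) T)} {X : Matrix (Fin 2) (Fin 2) T} :
    X ∈ matricesOf G ↔ ∃ g ∈ G, (g : Matrix (Fin 2) (Fin 2) T) = X := Iff.rfl

theorem coe_mem_matricesOf {G : Subgroup (GL (Fin 2) T)} {g : GL (Fin 2) T} :
    (g : Matrix (Fin 2) (Fin 2) T) ∈ matricesOf G ↔ g ∈ G := by
  rw [mem_matricesOf]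
  exact ⟨fun ⟨h, hh, e⟩ => Units.ext e ▸ hh, fun h => ⟨g, h, rfl⟩⟩

theorem inv_mem_matricesOf {G : Subgroup (GL (Fin 2) T)} {X Y : Matrix (Fin 2) (Fin 2) T}
    (hX : X ∈ matricesOf G) (h : X * Y = 1) : Y ∈ matricesOf G := by
  obtain ⟨g, hg, rfl⟩ := mem_matricesOf.1 hX
  refine mem_matricesOf.2 ⟨g⁻¹, G.inv_mem hg, ?_⟩
  rw [← mul_one ((g⁻¹ : GL (Fin 2) T) : Matrix (Fin 2) (Fin 2) T), ← h, ← mul_assoc,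
    Units.inv_mul, one_mul]

theorem mem_matricesOf_conj {G : Subgroup (GL (Fin 2) T)} {u : GL (Fin 2) T}
    {X Y : Matrix (Fin 2) (Fin 2) T} (hX : X ∈ matricesOf G)
    (h : (u : Matrix (Fin 2) (Fin 2) T) * X = Y * u) :
    Y ∈ matricesOf (G.map (MulAut.conj u).toMonoidHom) := by
  obtain ⟨g, hg, rfl⟩ := mem_matricesOf.1 hX
  refine mem_matricesOf.2 ⟨_, Subgroup.mem_map_of_mem _ hg, ?_⟩
  change ((u * g * u⁻¹ : GL (Fin 2) T) : Matrix (Fin 2) (Fin 2) T) = _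
  rw [Units.val_mul, Units.val_mul, h, mul_assoc, Units.mul_inv, mul_one]

namespace HasFullReduction

variable {π : T →ₐ[k] k} {D : Subgroup kˣ} {G : Subgroup (GL (Fin 2) T)}

theorem conj (h : HasFullReduction π D G) (u : GL (Fin 2) T)
    (hu : Matrix.GeneralLinearGroup.map (π : T →+* k) u = 1) :
    HasFullReduction π D (G.map (MulAut.conj u).toMonoidHom) := by
  constructor
  · rw [← h.map_eq, Subgroup.map_map]
    congr 1
    ext1 g
    change Matrix.GeneralLinearGroup.map (π : T →+* k) (u * g * u⁻¹) = _
    rw [map_mul, map_mul, map_inv, hu, one_mul, inv_one, mul_one]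
  · rintro _ ⟨g, hg, rfl⟩
    have := h.le hg
    rw [GLTwoDet, Subgroup.mem_comap] at this ⊢
    change Matrix.GeneralLinearGroup.det (u * g * u⁻¹) ∈ _
    rwa [map_mul, map_mul, mul_right_comm, ← map_mul, mul_inv_cancel, map_one, one_mul]

/-- Every element of `GL_2^D(k)` lifts to `G`. -/
theorem exists_lift (h : HasFullReduction π D G) {γ : GL (Fin 2) k} (hγ : γ ∈ GLTwoDet D k) :
    ∃ g ∈ G, Matrix.GeneralLinearGroup.map (π : T →+* k) g = γ := by
  rw [← h.map_eq] at hγ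
  exact hγ

theorem det_eq (h : HasFullReduction π D G) {X : Matrix (Fin 2) (Fin 2) T}
    (hX : X ∈ matricesOf G) : X.det = algebraMap k T (π X.det) := by
  obtain ⟨g, hg, rfl⟩ := mem_matricesOf.1 hX
  obtain ⟨d, -, hd⟩ := h.le hg
  have : (g : Matrix (Fin 2) (Fin 2) T).det = algebraMap k T d := (congrArg Units.val hd).symm
  rw [this, AlgHom.commutes]; rfl

/-- Dividing X by the constant lift of γ leaves a matrix 1 + A with A ≡ 0 and determinant 1. Hence
tr A = 0, and in characteristic 2 the two diagonal entries agree. -/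
theorem exists_factor (h : HasFullReduction π D G) (hπ : ∀ x y, π x = 0 → π y = 0 → x * y = 0)
    [CharP k 2] {γ : Matrix (Fin 2) (Fin 2) k} {X : Matrix (Fin 2) (Fin 2) T}
    (hX : X ∈ matricesOf G) (hXγ : X.map π = γ) (hγ : γ.det ≠ 0) :
    ∃ x b c : T, π x = 0 ∧ π b = 0 ∧ π c = 0 ∧
      X = !![1 + x, b; c, 1 + x] * (algebraMap k T).mapMatrix γ := by
  set Γ := (algebraMap k T).mapMatrix γ with hΓ
  set Γ' := (algebraMap k T).mapMatrix γ⁻¹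
  have hΓΓ : Γ' * Γ = 1 := by
    rw [← map_mul, Matrix.nonsing_inv_mul _ (isUnit_iff_ne_zero.2 hγ), map_one]
  have h2 : (2 : T) = 0 := two_eq_zero_of_algebra k
  have hYπ : (X * Γ').map π = 1 := by
    have h1 : (π : T →+* k).mapMatrix X = γ := hXγ
    have h3 : (π : T →+* k).mapMatrix Γ' = γ⁻¹ := by
      ext i j; simp [Γ']
    change (π : T →+* k).mapMatrix (X * Γ') = 1
    rw [map_mul, h1, h3, Matrix.mul_nonsing_inv _ (isUnit_iff_ne_zero.2 hγ)]
  have hXY : X = (X * Γ') * Γ := by rw [mul_assoc, hΓΓ, mul_one]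
  -- Determinants in G are constants, so det X is the constant det γ itself and not just congruent
  -- to it.
  have hdet : (X * Γ').det = 1 := by
    have h1 : X.det = algebraMap k T γ.det := by
      rw [h.det_eq hX, ← hXγ]
      congr 1
      exact (π : T →+* k).map_det X
    have h3 : Γ'.det = algebraMap k T γ.det⁻¹ := by
      rw [← RingHom.map_det, Matrix.det_nonsing_inv, Ring.inverse_eq_inv']
    rw [Matrix.det_mul, h1, h3, ← map_mul, mul_inv_cancel₀ hγ, map_one]
  generalize X * Γ' = Y at hYπ hdet hXY
  have e00 : π (Y 0 0) = 1 := congrFun (congrFun hYπ 0) 0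
  have e01 : π (Y 0 1) = 0 := congrFun (congrFun hYπ 0) 1
  have e10 : π (Y 1 0) = 0 := congrFun (congrFun hYπ 1) 0
  have e11 : π (Y 1 1) = 1 := congrFun (congrFun hYπ 1) 1
  have hx : π (Y 0 0 - 1) = 0 := by rw [map_sub, e00, map_one, sub_self]
  have hy : π (Y 1 1 - 1) = 0 := by rw [map_sub, e11, map_one, sub_self]
  have hbc := hπ _ _ e01 e10
  have hxy := hπ _ _ hx hy
  refine ⟨Y 0 0 - 1, Y 0 1, Y 1 0, hx, e01, e10, ?_⟩
  rw [hXY]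
  congr 1
  rw [Matrix.det_fin_two, hbc] at hdet
  rw [Matrix.eta_fin_two Y]
  simp only [Matrix.of_apply, Matrix.cons_val', Matrix.cons_val_zero, Matrix.cons_val_one, Matrix.cons_val_fin_one]
  refine Matrix.fin_two_congr (by ring) rfl rfl ?_
  linear_combination hdet - hxy + (1 - Y 0 0) * h2

end HasFullReduction
end FullReduction

/-! ### Conjugation-stable groups of matrices in characteristic 2 -/

section Submodules

variable {k T : Type*} [Field k] [CommRing T] [Algebra k T]

theorem exists_sq_eq [Finite k] [CharP k 2] (r : k) : ∃ s : k, s ^ 2 = r := by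
  obtain ⟨s, hs⟩ := FiniteField.isSquare_of_char_two (ringChar.eq k 2) r
  exact ⟨s, by rw [hs, sq]⟩

theorem exists_ne_zero_ne_one (hk : 2 < Nat.card k) : ∃ a : k, a ≠ 0 ∧ a ≠ 1 := by
  have : Finite k := Nat.finite_of_card_ne_zero (by omega)
  have := Fintype.ofFinite k
  classical
  by_contra! h
  have : (Finset.univ : Finset k) ⊆ {0, 1} := fun a _ => by
    by_cases ha : a = 0 <;> simp_all
  have h1 := (Finset.card_le_card this).trans Finset.card_le_two
  rw [Finset.card_univ, ← Nat.card_eq_fintype_card] at h1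
  omega

/-- A matrix of determinant one, as an element of `GL_2^D(k)`. -/
def GLTwoDet.ofDetOne (D : Subgroup kˣ) (γ : Matrix (Fin 2) (Fin 2) k) (h : γ.det = 1) :
    GLTwoDet D k :=
  ⟨⟨γ, γ.adjugate, by rw [Matrix.mul_adjugate, h, one_smul],
    by rw [Matrix.adjugate_mul, h, one_smul]⟩, by
    rw [mem_GLTwoDet_self]
    convert D.one_mem
    ext
    exact h⟩

namespace ConjSubmodule

variable {D : Subgroup kˣ} {π : T →ₐ[k] k} {M : ConjSubmodule D T}

/-- The analysis of submodules only uses conjugation by SL_2(k), which lies in GL_2^D(k) for every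
D; the adjugate serves as explicit inverse. -/
theorem conj_mem_of_det_eq_one {γ : Matrix (Fin 2) (Fin 2) k} (hγ : γ.det = 1)
    {A : Matrix (Fin 2) (Fin 2) T} (hA : A ∈ M.toAddSubgroup) :
    (algebraMap k T).mapMatrix γ * A * (algebraMap k T).mapMatrix γ.adjugate ∈
      M.toAddSubgroup := by
  exact M.conj_mem (GLTwoDet.ofDetOne D γ hγ) (GLTwoDet.ofDetOne D γ hγ).2 A hA

theorem torus_conj_mem {x b c : T} (h : !![x, b; c, x] ∈ M.toAddSubgroup) {a : k} (ha : a ≠ 0) :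
    !![x, algebraMap k T (a ^ 2) * b; algebraMap k T (a⁻¹ ^ 2) * c, x] ∈ M.toAddSubgroup := by
  have h1 := conj_mem_of_det_eq_one (γ := !![a, 0; 0, a⁻¹])
    (by simp [Matrix.det_fin_two, ha]) h
  convert h1 using 1
  have e : algebraMap k T a * algebraMap k T a⁻¹ = 1 := by
    rw [← map_mul, mul_inv_cancel₀ ha, map_one]
  simp only [Matrix.adjugate_fin_two_of, RingHom.mapMatrix_apply, Matrix.map_apply, Matrix.eta_fin_two (Matrix.map _ _), Matrix.of_apply, Matrix.cons_val', Matrix.cons_val_zero, Matrix.cons_val_one, Matrix.cons_val_fin_one,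
    Matrix.mul_fin_two, map_zero, map_neg, map_pow]
  refine Matrix.fin_two_congr ?_ ?_ ?_ ?_ <;> grind

theorem upper_conj_mem [CharP k 2] {x b c : T} (h : !![x, b; c, x] ∈ M.toAddSubgroup) (s : k) :
    !![x + algebraMap k T s * c, b + algebraMap k T (s ^ 2) * c; c, x + algebraMap k T s * c] ∈
      M.toAddSubgroup := by
  have h1 := conj_mem_of_det_eq_one (γ := !![1, s; 0, 1]) (by simp [Matrix.det_fin_two]) h
  convert h1 using 1
  have e : (2 : T) = 0 := two_eq_zero_of_algebra k
  simp only [Matrix.adjugate_fin_two_of, RingHom.mapMatrix_apply, Matrix.map_apply, Matrix.eta_fin_two (Matrix.map _ _), Matrix.of_apply, Matrix.cons_val', Matrix.cons_val_zero, Matrix.cons_val_one, Matrix.cons_val_fin_one,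
    Matrix.mul_fin_two, map_zero, map_neg, map_one, map_pow]
  refine Matrix.fin_two_congr ?_ ?_ ?_ ?_ <;> grind

theorem swap_mem [CharP k 2] {x b c : T} (h : !![x, b; c, x] ∈ M.toAddSubgroup) :
    !![x, c; b, x] ∈ M.toAddSubgroup := by
  have e : (2 : T) = 0 := two_eq_zero_of_algebra k
  have h1 := conj_mem_of_det_eq_one (γ := !![0, 1; 1, 0])
    (by simp [Matrix.det_fin_two, CharTwo.neg_eq]) h
  convert h1 using 1
  simp only [Matrix.adjugate_fin_two_of, RingHom.mapMatrix_apply, Matrix.map_apply, Matrix.eta_fin_two (Matrix.map _ _), Matrix.of_apply, Matrix.cons_val', Matrix.cons_val_zero, Matrix.cons_val_one, Matrix.cons_val_fin_one,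
    Matrix.mul_fin_two, map_zero, map_neg, map_one]
  refine Matrix.fin_two_congr ?_ ?_ ?_ ?_ <;> grind

theorem add_mem_fin_two {a b c d a' b' c' d' : T} (h : !![a, b; c, d] ∈ M.toAddSubgroup)
    (h' : !![a', b'; c', d'] ∈ M.toAddSubgroup) :
    !![a + a', b + b'; c + c', d + d'] ∈ M.toAddSubgroup := by
  have := M.toAddSubgroup.add_mem h h'
  simpa using this

variable [Finite k] [CharP k 2] (hk : 2 < Nat.card k)
include hk

/-- Adding the conjugate by a unipotent with entry s leaves sc on the diagonal and s²c above it.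
Adding a torus conjugate of that cancels the diagonal and leaves (1 + a²)s²c. An a ≠ 0, 1 exists
because q > 2, and then s can be chosen with (1 + a²)s² = r, all elements of k being squares. -/
theorem upper_mem_of_lower_entry {x b c : T} (h : !![x, b; c, x] ∈ M.toAddSubgroup) (r : k) :
    !![0, algebraMap k T r * c; 0, 0] ∈ M.toAddSubgroup := by
  have e : (2 : T) = 0 := two_eq_zero_of_algebra k
  obtain ⟨a, ha, ha1⟩ := exists_ne_zero_ne_one hk
  have ha2 : 1 + a ^ 2 ≠ 0 := by
    have : 1 + a ^ 2 = (1 + a) ^ 2 := by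
      rw [CharTwo.add_sq, one_pow]
    rw [this]
    refine pow_ne_zero _ fun h0 => ha1 ?_
    rw [← sub_eq_zero, CharTwo.sub_eq_add, add_comm, h0]
  obtain ⟨s, hs⟩ := exists_sq_eq (r / (1 + a ^ 2))
  have h1 := add_mem_fin_two h (upper_conj_mem h s)
  have h2 : !![algebraMap k T s * c, algebraMap k T (s ^ 2) * c; 0, algebraMap k T s * c] ∈
      M.toAddSubgroup := by
    convert h1 using 1
    refine Matrix.fin_two_congr ?_ ?_ ?_ ?_ <;> grind
  have h3 := add_mem_fin_two h2 (torus_conj_mem h2 ha)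
  convert h3 using 1
  have hr : algebraMap k T r = (1 + algebraMap k T (a ^ 2)) * algebraMap k T (s ^ 2) := by
    rw [← map_one (algebraMap k T), ← map_add, ← map_mul, hs, mul_div_cancel₀ _ ha2]
  rw [hr]
  refine Matrix.fin_two_congr ?_ ?_ ?_ ?_ <;> grind

theorem scalar_mem_of_lower_entry {x b c : T} (h : !![x, b; c, x] ∈ M.toAddSubgroup) (r : k) :
    !![algebraMap k T r * c, 0; 0, algebraMap k T r * c] ∈ M.toAddSubgroup := by
  have e : (2 : T) = 0 := two_eq_zero_of_algebra k
  have h1 := add_mem_fin_two (add_mem_fin_two h (upper_conj_mem h r))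
    (upper_mem_of_lower_entry hk h (r ^ 2))
  convert h1 using 1
  refine Matrix.fin_two_congr ?_ ?_ ?_ ?_ <;> grind

end ConjSubmodule
end Submodules

/-! ### The kernel of reduction as a module, and the split torus -/

section Kernel

variable {k T : Type*} [Field k] [CommRing T] [Algebra k T]

theorem Matrix.mul_eq_zero_of_map_eq_zero {n : Type*} [Fintype n] {π : T →ₐ[k] k}
    (hπ : ∀ x y, π x = 0 → π y = 0 → x * y = 0) {A B : Matrix n n T}
    (hA : ∀ i j, π (A i j) = 0) (hB : ∀ i j, π (B i j) = 0) : A * B = 0 := by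
  ext i j
  rw [Matrix.mul_apply]
  exact Finset.sum_eq_zero fun l _ => hπ _ _ (hA i l) (hB l j)

theorem Matrix.map_eq_zero_mul_mul {n : Type*} [Fintype n] {π : T →ₐ[k] k}
    {A : Matrix n n T} (hA : ∀ i j, π (A i j) = 0) (P Q : Matrix n n T) (i j : n) :
    π ((P * A * Q) i j) = 0 := by
  rw [Matrix.mul_apply, map_sum]
  refine Finset.sum_eq_zero fun l _ => ?_
  rw [map_mul, Matrix.mul_apply, map_sum, Finset.sum_eq_zero, zero_mul]
  intro p _
  rw [map_mul, hA, mul_zero]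

namespace HasFullReduction

variable {π : T →ₐ[k] k} {D : Subgroup kˣ} {G : Subgroup (GL (Fin 2) T)}

/-- Since 𝔪² = 0, conjugation on M_2(𝔪) sees only the reduction of the conjugating matrix. This lets
GL_2^D(k) act on the kernel even before G is known to contain it. -/
theorem conj_lift_eq (hπ : ∀ x y, π x = 0 → π y = 0 → x * y = 0) {g : GL (Fin 2) T}
    {γ : GL (Fin 2) k} (hg : Matrix.GeneralLinearGroup.map (π : T →+* k) g = γ)
    {A : Matrix (Fin 2) (Fin 2) T} (hA : ∀ i j, π (A i j) = 0) :
    (algebraMap k T).mapMatrix (γ : Matrix (Fin 2) (Fin 2) k) * A *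
      (algebraMap k T).mapMatrix ((γ⁻¹ : GL (Fin 2) k) : Matrix (Fin 2) (Fin 2) k) =
    g * A * ((g⁻¹ : GL (Fin 2) T) : Matrix (Fin 2) (Fin 2) T) := by
  have key : ∀ g' : GL (Fin 2) T, ∀ γ' : GL (Fin 2) k,
      Matrix.GeneralLinearGroup.map (π : T →+* k) g' = γ' → ∀ i j,
      π ((((algebraMap k T).mapMatrix (γ' : Matrix (Fin 2) (Fin 2) k) - g' :
        Matrix (Fin 2) (Fin 2) T)) i j) = 0 := by
    rintro g' _ rfl i j
    rw [Matrix.sub_apply, map_sub, RingHom.mapMatrix_apply, Matrix.map_apply, AlgHom.commutes]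
    exact sub_self _
  have h1 := Matrix.mul_eq_zero_of_map_eq_zero hπ (key _ _ hg) hA
  have h2 := Matrix.mul_eq_zero_of_map_eq_zero hπ hA (key g⁻¹ γ⁻¹ (by rw [map_inv, hg]))
  rw [sub_mul, sub_eq_zero] at h1
  rw [mul_sub, sub_eq_zero] at h2
  rw [h1, mul_assoc, h2, mul_assoc]

/-- The module of the matrices `A` with `1 + A ∈ G` and `A ≡ 0`. -/
def kernelModule (h : HasFullReduction π D G) (hπ : ∀ x y, π x = 0 → π y = 0 → x * y = 0) :
    ConjSubmodule D T where
  toAddSubgroup :=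
    { carrier := {A | (∀ i j, π (A i j) = 0) ∧ 1 + A ∈ matricesOf G}
      zero_mem' := ⟨fun _ _ => map_zero π, by rw [add_zero]; exact one_mem _⟩
      add_mem' := fun {A B} hA hB =>
        ⟨fun i j => by rw [Matrix.add_apply, map_add, hA.1, hB.1, add_zero], by
          have := mul_mem hA.2 hB.2
          rwa [add_mul, mul_add, mul_add, Matrix.mul_eq_zero_of_map_eq_zero hπ hA.1 hB.1, one_mul,
            one_mul, mul_one, add_zero, add_assoc, add_comm B A] at this⟩
      neg_mem' := fun {A} hA =>
        ⟨fun i j => by rw [Matrix.neg_apply, map_neg, hA.1, neg_zero], by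
          refine inv_mem_matricesOf hA.2 ?_
          rw [add_mul, mul_add, mul_add, mul_neg, mul_neg,
            Matrix.mul_eq_zero_of_map_eq_zero hπ hA.1 hA.1]
          simp⟩ }
  conj_mem := by
    rintro γ hγ A ⟨hA, hAG⟩
    refine ⟨Matrix.map_eq_zero_mul_mul hA _ _, ?_⟩
    obtain ⟨g, hg, hgγ⟩ := h.exists_lift hγ
    rw [conj_lift_eq hπ hgγ hA]
    have := mul_mem (mul_mem (coe_mem_matricesOf.2 hg) hAG) (coe_mem_matricesOf.2 (G.inv_mem hg))
    rwa [mul_add, add_mul, mul_one, Units.mul_inv] at this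

theorem mem_kernelModule (h : HasFullReduction π D G)
    (hπ : ∀ x y, π x = 0 → π y = 0 → x * y = 0) {A : Matrix (Fin 2) (Fin 2) T} :
    A ∈ (h.kernelModule hπ).toAddSubgroup ↔ (∀ i j, π (A i j) = 0) ∧ 1 + A ∈ matricesOf G :=
  Iff.rfl

/-- The determinant of 1 + A is 1 + tr A; it is also a constant congruent to 1, hence 1. -/
theorem kernelModule_le (h : HasFullReduction π D G)
    (hπ : ∀ x y, π x = 0 → π y = 0 → x * y = 0) :
    (h.kernelModule hπ).toAddSubgroup ≤
      (ConjSubmodule.traceZero D (RingHom.ker π)).toAddSubgroup := by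
  rintro A ⟨hA, hAG⟩
  refine ⟨?_, hA⟩
  have h1 := h.det_eq hAG
  have h2 : π (1 + A).det = 1 := by
    have : (π : T →+* k).mapMatrix A = 0 := by ext i j; exact hA i j
    have h3 := (π : T →+* k).map_det (1 + A)
    rw [map_add, map_one, this, add_zero, Matrix.det_one] at h3
    exact h3
  have h3 := hπ _ _ (hA 0 0) (hA 1 1)
  have h4 := hπ _ _ (hA 0 1) (hA 1 0)
  rw [h2, map_one, Matrix.det_fin_two] at h1
  simp only [Matrix.add_apply, Matrix.one_apply_eq, Matrix.one_apply_ne (zero_ne_one' (Fin 2)),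
    Matrix.one_apply_ne (one_ne_zero' (Fin 2))] at h1
  rw [Matrix.trace_fin_two]
  linear_combination h1 - h3 + h4

theorem exists_mem_of_det_eq_one (h : HasFullReduction π D G)
    (hπ : ∀ x y, π x = 0 → π y = 0 → x * y = 0) [CharP k 2]
    {γ : GL (Fin 2) k} (hγ : γ ∈ GLTwoDet D k) :
    ∃ x b c : T, π x = 0 ∧ π b = 0 ∧ π c = 0 ∧
      !![1 + x, b; c, 1 + x] * (algebraMap k T).mapMatrix (γ : Matrix (Fin 2) (Fin 2) k) ∈
        matricesOf G := by
  obtain ⟨g, hg, rfl⟩ := h.exists_lift hγ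
  obtain ⟨x, b, c, hx, hb, hc, e⟩ := h.exists_factor hπ (coe_mem_matricesOf.2 hg) rfl
    (Matrix.GeneralLinearGroup.det_ne_zero (Matrix.GeneralLinearGroup.map (π : T →+* k) g))
  refine ⟨x, b, c, hx, hb, hc, ?_⟩
  have := coe_mem_matricesOf.2 hg
  rwa [e] at this

/-- A `2 × 2` matrix congruent to `1`, of determinant one. -/
theorem exists_unit (x y : T) (hx : π x = 0) (hy : π y = 0) (hxy : x * y = 0) :
    ∃ u : GL (Fin 2) T, Matrix.GeneralLinearGroup.map (π : T →+* k) u = 1 ∧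
      (u : Matrix (Fin 2) (Fin 2) T) = !![1, x; y, 1] := by
  refine ⟨⟨!![1, x; y, 1], !![1, -x; -y, 1], ?_, ?_⟩, ?_, rfl⟩
  · rw [Matrix.mul_fin_two, Matrix.one_fin_two]
    refine Matrix.fin_two_congr ?_ ?_ ?_ ?_ <;> grind
  · rw [Matrix.mul_fin_two, Matrix.one_fin_two]
    refine Matrix.fin_two_congr ?_ ?_ ?_ ?_ <;> grind
  · ext i j
    fin_cases i <;> fin_cases j <;> simp [hx, hy]

theorem exists_unit_diag (y : T) (hy : π y = 0) (hyy : y * y = 0) :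
    ∃ u : GL (Fin 2) T, Matrix.GeneralLinearGroup.map (π : T →+* k) u = 1 ∧
      (u : Matrix (Fin 2) (Fin 2) T) = !![1 + y, 0; 0, 1] := by
  refine ⟨⟨!![1 + y, 0; 0, 1], !![1 - y, 0; 0, 1], ?_, ?_⟩, ?_, rfl⟩
  · rw [Matrix.mul_fin_two, Matrix.one_fin_two]
    refine Matrix.fin_two_congr ?_ ?_ ?_ ?_ <;> grind
  · rw [Matrix.mul_fin_two, Matrix.one_fin_two]
    refine Matrix.fin_two_congr ?_ ?_ ?_ ?_ <;> grind
  · ext i j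
    fin_cases i <;> fin_cases j <;> simp [hy]

/-- A generator ζ of kˣ satisfies ζ ≠ ζ⁻¹ because q > 2, so a lift of diag(ζ, ζ⁻¹) can be
diagonalised by a matrix congruent to 1. The remaining factor 1 + x squares to 1, and even powers of
ζ already exhaust kˣ. -/
theorem exists_conj_torus (h : HasFullReduction π D G)
    (hπ : ∀ x y, π x = 0 → π y = 0 → x * y = 0) [Finite k] [CharP k 2] (hk : 2 < Nat.card k) :
    ∃ u : GL (Fin 2) T, Matrix.GeneralLinearGroup.map (π : T →+* k) u = 1 ∧
      ∀ a : k, a ≠ 0 → !![algebraMap k T a, 0; 0, algebraMap k T a⁻¹] ∈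
        matricesOf (G.map (MulAut.conj u).toMonoidHom) := by
  have e : (2 : T) = 0 := two_eq_zero_of_algebra k
  obtain ⟨ζ, hζ⟩ := IsCyclic.exists_generator (α := kˣ)
  have hne : (ζ : k) + (ζ : k)⁻¹ ≠ 0 := by
    intro h0
    obtain ⟨a, ha, ha1⟩ := exists_ne_zero_ne_one hk
    have h1 : (ζ : k) * ζ = 1 := by
      rw [CharTwo.add_eq_zero] at h0
      nth_rewrite 2 [h0]
      exact mul_inv_cancel₀ ζ.ne_zero
    have h2 : ζ = 1 := by
      ext
      have : ((ζ : k) + 1) ^ 2 = 0 := by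
        rw [CharTwo.add_sq, one_pow, sq, h1, CharTwo.add_self_eq_zero]
      rw [Units.val_one, ← sub_eq_zero, CharTwo.sub_eq_add]
      exact pow_eq_zero_iff two_ne_zero |>.1 this
    obtain ⟨n, hn⟩ := hζ (Units.mk0 a ha)
    rw [h2] at hn
    apply ha1
    have := congrArg Units.val hn
    simpa using this.symm
  obtain ⟨x, b, c, hx, hb, hc, hX⟩ := h.exists_mem_of_det_eq_one hπ
    (GLTwoDet.ofDetOne D !![(ζ : k), 0; 0, (ζ : k)⁻¹] (by simp [Matrix.det_fin_two])).2
  change _ * (algebraMap k T).mapMatrix !![(ζ : k), 0; 0, (ζ : k)⁻¹] ∈ _ at hX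
  set z := algebraMap k T ζ with hz
  set z' := algebraMap k T (ζ : k)⁻¹ with hz'
  set v := algebraMap k T ((ζ : k) + (ζ : k)⁻¹)⁻¹ with hv
  have hv1 : v * (z + z') = 1 := by
    rw [hz, hz', hv, ← map_add, ← map_mul, inv_mul_cancel₀ hne, map_one]
  have hzz : z * z' = 1 := by
    rw [hz, hz', ← map_mul, mul_inv_cancel₀ ζ.ne_zero, map_one]
  have hbc := hπ _ _ hb hc
  have hxb := hπ _ _ hx hb
  have hxc := hπ _ _ hx hc
  have hxx := hπ _ _ hx hx
  -- These entries solve the two linear equations expressing that u X u⁻¹ is diagonal; v inverts z +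
  -- z' = z - z'.
  obtain ⟨u, hu, hu'⟩ := exists_unit (π := π) (v * z' * b) (v * z * c)
    (by rw [map_mul, hb, mul_zero]) (by rw [map_mul, hc, mul_zero])
    (by linear_combination v * z' * v * z * hbc)
  have hY : !![(1 + x) * z, 0; 0, (1 + x) * z'] ∈
      matricesOf (G.map (MulAut.conj u).toMonoidHom) := by
    refine mem_matricesOf_conj hX ?_
    rw [hu']
    simp only [RingHom.mapMatrix_apply, Matrix.map_apply, Matrix.eta_fin_two (Matrix.map _ _),
      Matrix.of_apply, Matrix.cons_val', Matrix.cons_val_zero, Matrix.cons_val_one,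
      Matrix.cons_val_fin_one, Matrix.mul_fin_two, map_zero, ← hz, ← hz']
    refine Matrix.fin_two_congr ?_ ?_ ?_ ?_ <;> grind
  have hpow : ∀ n : ℕ, !![(1 + x) * z, 0; 0, (1 + x) * z'] ^ n =
      !![(1 + x) ^ n * z ^ n, 0; 0, (1 + x) ^ n * z' ^ n] := by
    intro n
    induction n with
    | zero => simp [Matrix.one_fin_two]
    | succ n ih =>
      rw [pow_succ, ih, Matrix.mul_fin_two]
      refine Matrix.fin_two_congr ?_ ?_ ?_ ?_ <;> ring
  refine ⟨u, hu, fun a ha => ?_⟩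
  obtain ⟨s, hs⟩ := exists_sq_eq a
  have hs0 : s ≠ 0 := by
    rintro rfl
    exact ha (by rw [← hs, zero_pow two_ne_zero])
  obtain ⟨n, hn⟩ := mem_powers_iff_mem_zpowers.2 (hζ (Units.mk0 s hs0))
  have hn' : (ζ : k) ^ n = s := by simpa using congrArg Units.val hn
  have ha' : (ζ : k) ^ (2 * n) = a := by rw [mul_comm, pow_mul, hn', hs]
  have h1 := pow_mem hY (2 * n)
  have h2 : (1 + x) ^ (2 * n) = 1 := by
    rw [pow_mul]
    have : (1 + x) ^ 2 = 1 := by linear_combination hxx + x * e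
    rw [this, one_pow]
  rwa [hpow, h2, one_mul, one_mul, hz, hz', ← map_pow, ← map_pow, inv_pow, ha'] at h1

end HasFullReduction
end Kernel

/-! ### Conjugating the image so that it contains GL_2^D(k) -/

section Conjugation

variable {k T : Type*} [Field k] [CommRing T] [Algebra k T]

namespace HasFullReduction

variable {π : T →ₐ[k] k} {D : Subgroup kˣ} {G : Subgroup (GL (Fin 2) T)}

theorem exists_factor_lift_fin_two (h : HasFullReduction π D G)
    (hπ : ∀ x y, π x = 0 → π y = 0 → x * y = 0) [CharP k 2] {p q r s : k}
    (hγ : !![p, q; r, s].det = 1) :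
    ∃ x b c : T, π x = 0 ∧ π b = 0 ∧ π c = 0 ∧
      !![1 + x, b; c, 1 + x] * !![algebraMap k T p, algebraMap k T q;
        algebraMap k T r, algebraMap k T s] ∈ matricesOf G := by
  obtain ⟨x, b, c, hx, hb, hc, hX⟩ := h.exists_mem_of_det_eq_one hπ
    (GLTwoDet.ofDetOne D _ hγ).2
  refine ⟨x, b, c, hx, hb, hc, ?_⟩
  convert hX using 2
  change _ = (algebraMap k T).mapMatrix !![p, q; r, s]
  rw [Matrix.eta_fin_two ((algebraMap k T).mapMatrix !![p, q; r, s])]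
  rfl

theorem kernel_mul_mem (h : HasFullReduction π D G)
    (hπ : ∀ x y, π x = 0 → π y = 0 → x * y = 0) {x y z w : T}
    (hM : !![x, y; z, w] ∈ (h.kernelModule hπ).toAddSubgroup) :
    !![1 + x, y; z, 1 + w] ∈ matricesOf G := by
  have := hM.2
  rw [Matrix.one_fin_two] at this
  simpa using this

theorem mem_kernel (h : HasFullReduction π D G)
    (hπ : ∀ x y, π x = 0 → π y = 0 → x * y = 0) {x y z w : T}
    (hx : π x = 0) (hy : π y = 0) (hz : π z = 0) (hw : π w = 0)
    (hX : !![1 + x, y; z, 1 + w] ∈ matricesOf G) :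
    !![x, y; z, w] ∈ (h.kernelModule hπ).toAddSubgroup := by
  refine ⟨fun i j => by fin_cases i <;> fin_cases j <;> assumption, ?_⟩
  rw [Matrix.one_fin_two]
  simpa using hX

variable [Finite k] [CharP k 2] (hk : 2 < Nat.card k)
include hk

/-- A lift of the standard unipotent squares into the kernel, which shows that its lower-left error
c is an off-diagonal entry of the kernel module and can be cleared inside G. The upper-right error b
is removed by conjugating with diag(1 + b, 1), which commutes with the torus already obtained. -/
theorem exists_conj_unipotent (h : HasFullReduction π D G)
    (hπ : ∀ x y, π x = 0 → π y = 0 → x * y = 0)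
    (ht : ∀ a : k, a ≠ 0 → !![algebraMap k T a, 0; 0, algebraMap k T a⁻¹] ∈ matricesOf G) :
    ∃ u : GL (Fin 2) T, Matrix.GeneralLinearGroup.map (π : T →+* k) u = 1 ∧
      (∀ a : k, a ≠ 0 → !![algebraMap k T a, 0; 0, algebraMap k T a⁻¹] ∈
        matricesOf (G.map (MulAut.conj u).toMonoidHom)) ∧
      ∃ x : T, π x = 0 ∧
        !![1 + x, 1 + x; 0, 1 + x] ∈ matricesOf (G.map (MulAut.conj u).toMonoidHom) := by
  have e : (2 : T) = 0 := two_eq_zero_of_algebra k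
  obtain ⟨x, b, c, hx, hb, hc, hX⟩ := h.exists_factor_lift_fin_two hπ
    (p := 1) (q := 1) (r := 0) (s := 1) (by simp [Matrix.det_fin_two])
  have hxx := hπ _ _ hx hx
  have hxb := hπ _ _ hx hb
  have hxc := hπ _ _ hx hc
  have hbc := hπ _ _ hb hc
  have hbb := hπ _ _ hb hb
  have hcc := hπ _ _ hc hc
  rw [map_one, map_zero, Matrix.mul_fin_two] at hX
  have hXX := mul_mem hX hX
  rw [Matrix.mul_fin_two] at hXX
  have hM : !![c, c; 0, c] ∈ (h.kernelModule hπ).toAddSubgroup := by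
    refine h.mem_kernel hπ hc hc (map_zero π) hc ?_
    convert hXX using 1
    refine Matrix.fin_two_congr ?_ ?_ ?_ ?_ <;> grind
  have hM' := ConjSubmodule.upper_mem_of_lower_entry hk (ConjSubmodule.swap_mem hM) 1
  rw [map_one, one_mul] at hM'
  have hX' := mul_mem (h.kernel_mul_mem hπ (ConjSubmodule.swap_mem hM')) hX
  rw [Matrix.mul_fin_two] at hX'
  obtain ⟨u, hu, hu'⟩ := exists_unit_diag (π := π) b hb hbb
  refine ⟨u, hu, fun a ha => mem_matricesOf_conj (ht a ha) ?_, x, hx,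
    mem_matricesOf_conj hX' ?_⟩
  · rw [hu', Matrix.mul_fin_two, Matrix.mul_fin_two]
    refine Matrix.fin_two_congr ?_ ?_ ?_ ?_ <;> grind
  · rw [hu', Matrix.mul_fin_two, Matrix.mul_fin_two]
    refine Matrix.fin_two_congr ?_ ?_ ?_ ?_ <;> grind

omit hk in
-- Torus conjugates of the given element are 1 + x times the unipotents with entry a². Multiplying
-- two of them removes the scalar, since (1 + x)² = 1.
theorem upper_mem (hk : 2 < Nat.card k) (hπ : ∀ x y, π x = 0 → π y = 0 → x * y = 0)
    (ht : ∀ a : k, a ≠ 0 → !![algebraMap k T a, 0; 0, algebraMap k T a⁻¹] ∈ matricesOf G)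
    {x : T} (hx : π x = 0) (hX : !![1 + x, 1 + x; 0, 1 + x] ∈ matricesOf G) (s : k) :
    !![1, algebraMap k T s; 0, 1] ∈ matricesOf G := by
  have e : (2 : T) = 0 := two_eq_zero_of_algebra k
  have hxx := hπ _ _ hx hx
  have key : ∀ a : k, a ≠ 0 →
      !![1 + x, (1 + x) * algebraMap k T (a ^ 2); 0, 1 + x] ∈ matricesOf G := by
    intro a ha
    have ha' : algebraMap k T a * algebraMap k T a⁻¹ = 1 := by
      rw [← map_mul, mul_inv_cancel₀ ha, map_one]
    have h1 := mul_mem (mul_mem (ht a ha) hX) (ht a⁻¹ (inv_ne_zero ha))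
    rw [inv_inv, Matrix.mul_fin_two, Matrix.mul_fin_two] at h1
    convert h1 using 1
    rw [map_pow]
    refine Matrix.fin_two_congr ?_ ?_ ?_ ?_ <;> grind
  obtain ⟨r, rfl⟩ := exists_sq_eq s
  -- The entry r² is written as a² + (r + a)² with both squares coming from torus elements; q > 2
  -- leaves room for such an a.
  obtain ⟨a, ha, hra⟩ : ∃ a : k, a ≠ 0 ∧ r + a ≠ 0 := by
    obtain ⟨b, hb, hb1⟩ := exists_ne_zero_ne_one hk
    by_cases hr : r = 0
    · exact ⟨1, one_ne_zero, by rw [hr, zero_add]; exact one_ne_zero⟩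
    · refine ⟨r * b, mul_ne_zero hr hb, fun h0 => hb1 ?_⟩
      rw [CharTwo.add_eq_zero] at h0
      exact mul_left_cancel₀ hr (by rw [mul_one, ← h0])
  have h1 := mul_mem (key a ha) (key (r + a) hra)
  rw [Matrix.mul_fin_two] at h1
  convert h1 using 1
  rw [CharTwo.add_sq, map_add]
  refine Matrix.fin_two_congr ?_ ?_ ?_ ?_ <;> grind

/-- A lift X of the Weyl element inverts the torus up to an element of the kernel. That element
isolates the errors b and c of X as off-diagonal entries of the kernel module, so X can be corrected
within G to 1 + x times the Weyl element. Conjugating upper unipotents by it gives the lower ones.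
-/
theorem lower_mem (h : HasFullReduction π D G)
    (hπ : ∀ x y, π x = 0 → π y = 0 → x * y = 0)
    (ht : ∀ a : k, a ≠ 0 → !![algebraMap k T a, 0; 0, algebraMap k T a⁻¹] ∈ matricesOf G)
    (hE : ∀ s : k, !![1, algebraMap k T s; 0, 1] ∈ matricesOf G) (s : k) :
    !![1, 0; algebraMap k T s, 1] ∈ matricesOf G := by
  have e : (2 : T) = 0 := two_eq_zero_of_algebra k
  obtain ⟨x, b, c, hx, hb, hc, hX⟩ := h.exists_factor_lift_fin_two hπ
    (p := 0) (q := 1) (r := 1) (s := 0) (by simp [Matrix.det_fin_two, CharTwo.neg_eq])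
  have hxx := hπ _ _ hx hx
  have hxb := hπ _ _ hx hb
  have hxc := hπ _ _ hx hc
  have hbc := hπ _ _ hb hc
  have hbb := hπ _ _ hb hb
  have hcc := hπ _ _ hc hc
  rw [map_one, map_zero, Matrix.mul_fin_two] at hX
  have hXinv := inv_mem_matricesOf hX (Y := !![c, 1 + x; 1 + x, b]) (by
    rw [Matrix.mul_fin_two, Matrix.one_fin_two]
    refine Matrix.fin_two_congr ?_ ?_ ?_ ?_ <;> grind)
  obtain ⟨a, ha, ha1⟩ := exists_ne_zero_ne_one hk
  have ha' : algebraMap k T a * algebraMap k T a⁻¹ = 1 := by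
    rw [← map_mul, mul_inv_cancel₀ ha, map_one]
  have hb' : π (b + algebraMap k T (a⁻¹ ^ 2) * b) = 0 := by
    rw [map_add, map_mul, hb, mul_zero, add_zero]
  have hc' : π (c + algebraMap k T (a ^ 2) * c) = 0 := by
    rw [map_add, map_mul, hc, mul_zero, add_zero]
  have hM : !![0, b + algebraMap k T (a⁻¹ ^ 2) * b; c + algebraMap k T (a ^ 2) * c, 0] ∈
      (h.kernelModule hπ).toAddSubgroup := by
    refine h.mem_kernel hπ (map_zero π) hb' hc' (map_zero π) ?_
    have h1 := mul_mem (mul_mem (mul_mem hX (ht a ha)) hXinv) (ht a ha)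
    rw [Matrix.mul_fin_two, Matrix.mul_fin_two, Matrix.mul_fin_two] at h1
    convert h1 using 1
    rw [map_pow, map_pow]
    refine Matrix.fin_two_congr ?_ ?_ ?_ ?_ <;> grind
  have hne : ∀ a : k, a ≠ 1 → 1 + a ^ 2 ≠ 0 := by
    intro a ha1
    rw [show 1 + a ^ 2 = (1 + a) ^ 2 by rw [CharTwo.add_sq, one_pow]]
    refine pow_ne_zero _ fun h0 => ha1 ?_
    rw [← sub_eq_zero, CharTwo.sub_eq_add, add_comm, h0]
  have hMc := ConjSubmodule.upper_mem_of_lower_entry hk hM (1 + a ^ 2)⁻¹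
  have hMb := ConjSubmodule.upper_mem_of_lower_entry hk (ConjSubmodule.swap_mem hM)
    (1 + a⁻¹ ^ 2)⁻¹
  have hcancel : ∀ a : k, a ≠ 1 → ∀ b : T,
      algebraMap k T (1 + a ^ 2)⁻¹ * (b + algebraMap k T (a ^ 2) * b) = b := by
    intro a ha1 b
    have : b + algebraMap k T (a ^ 2) * b = algebraMap k T (1 + a ^ 2) * b := by
      rw [map_add, map_one]; ring
    rw [this, ← mul_assoc, ← map_mul, inv_mul_cancel₀ (hne a ha1), map_one, one_mul]
  rw [hcancel a ha1] at hMc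
  rw [hcancel a⁻¹ (by simpa using ha1)] at hMb
  have hMbc := ConjSubmodule.add_mem_fin_two hMb (ConjSubmodule.swap_mem hMc)
  have hZ := mul_mem (h.kernel_mul_mem hπ hMbc) hX
  rw [Matrix.mul_fin_two] at hZ
  -- Z is its own inverse because (1 + x)² = 1, so this product is a conjugate.
  have h1 := mul_mem (mul_mem hZ (hE s)) hZ
  rw [Matrix.mul_fin_two, Matrix.mul_fin_two] at h1
  convert h1 using 1
  refine Matrix.fin_two_congr ?_ ?_ ?_ ?_ <;> grind

omit hk in
theorem exists_mem_sq_eq (D : Subgroup kˣ) {d : kˣ} (hd : d ∈ D) :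
    ∃ δ ∈ D, δ ^ 2 = d := by
  have := Fintype.ofFinite k
  -- The exponent q/2 inverts squaring, because d ^ q = d.
  refine ⟨d ^ (Fintype.card k / 2), D.pow_mem hd _, ?_⟩
  have h1 := FiniteField.even_card_of_char_two (ringChar.eq k 2)
  rw [← pow_mul, Nat.div_mul_cancel (Nat.dvd_of_mod_eq_zero h1)]
  ext
  rw [Units.val_pow_eq_pow_val, FiniteField.pow_card]

omit hk in
-- With δ = ε², a lift (1 + A)ε of the scalar ε squares to (1 + 2A + A²)ε² = δ, so the error
-- vanishes.
theorem scalar_mem (h : HasFullReduction π D G)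
    (hπ : ∀ x y, π x = 0 → π y = 0 → x * y = 0) {δ : kˣ} (hδ : δ ∈ D) :
    !![algebraMap k T δ, 0; 0, algebraMap k T δ] ∈ matricesOf G := by
  have e : (2 : T) = 0 := two_eq_zero_of_algebra k
  obtain ⟨ε, -, rfl⟩ := exists_mem_sq_eq D hδ
  obtain ⟨x, b, c, hx, hb, hc, hX⟩ := h.exists_mem_of_det_eq_one hπ
    (γ := Matrix.GeneralLinearGroup.mkOfDetNeZero !![(ε : k), 0; 0, ε]
      (by simp [Matrix.det_fin_two])) (by
      rw [mem_GLTwoDet_self]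
      convert hδ
      ext
      simp [Matrix.GeneralLinearGroup.mkOfDetNeZero, Matrix.det_fin_two, sq])
  have hε : (algebraMap k T).mapMatrix !![(ε : k), 0; 0, ε] =
      !![algebraMap k T ε, 0; 0, algebraMap k T ε] := by
    rw [Matrix.eta_fin_two ((algebraMap k T).mapMatrix !![(ε : k), 0; 0, ε])]
    simp
  change _ * (algebraMap k T).mapMatrix !![(ε : k), 0; 0, ε] ∈ _ at hX
  have hxx := hπ _ _ hx hx
  have hxb := hπ _ _ hx hb
  have hxc := hπ _ _ hx hc
  have hbc := hπ _ _ hb hc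
  rw [hε, Matrix.mul_fin_two] at hX
  have h1 := mul_mem hX hX
  rw [Matrix.mul_fin_two] at h1
  convert h1 using 1
  rw [Units.val_pow_eq_pow_val, map_pow]
  refine Matrix.fin_two_congr ?_ ?_ ?_ ?_ <;> grind

omit [Finite k] [CharP k 2] hk in
-- The torus and the two unipotent groups generate SL_2(k): upper triangular elements are torus
-- times unipotent, and those with lower-left entry c ≠ 0 are upper, lower, upper unipotent with c
-- in the middle.
theorem det_one_mem
    (ht : ∀ a : k, a ≠ 0 → !![algebraMap k T a, 0; 0, algebraMap k T a⁻¹] ∈ matricesOf G)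
    (hE : ∀ s : k, !![1, algebraMap k T s; 0, 1] ∈ matricesOf G)
    (hF : ∀ s : k, !![1, 0; algebraMap k T s, 1] ∈ matricesOf G)
    {γ : Matrix (Fin 2) (Fin 2) k} (hγ : γ.det = 1) :
    (algebraMap k T).mapMatrix γ ∈ matricesOf G := by
  have hE' : ∀ s : k, (algebraMap k T).mapMatrix !![1, s; 0, 1] ∈ matricesOf G := by
    intro s
    convert hE s using 1
    rw [Matrix.eta_fin_two ((algebraMap k T).mapMatrix !![1, s; 0, 1])]
    simp
  have hF' : ∀ s : k, (algebraMap k T).mapMatrix !![1, 0; s, 1] ∈ matricesOf G := by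
    intro s
    convert hF s using 1
    rw [Matrix.eta_fin_two ((algebraMap k T).mapMatrix !![1, 0; s, 1])]
    simp
  have ht' : ∀ a : k, a ≠ 0 → (algebraMap k T).mapMatrix !![a, 0; 0, a⁻¹] ∈ matricesOf G := by
    intro a ha
    convert ht a ha using 1
    rw [Matrix.eta_fin_two ((algebraMap k T).mapMatrix !![a, 0; 0, a⁻¹])]
    simp
  rw [Matrix.det_fin_two] at hγ
  rw [Matrix.eta_fin_two γ]
  generalize γ 0 0 = a, γ 0 1 = b, γ 1 0 = c, γ 1 1 = d at hγ ⊢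
  by_cases hc : c = 0
  · subst hc
    have ha : a ≠ 0 := by rintro rfl; simp at hγ
    have h1 := mul_mem (ht' a ha) (hE' (b / a))
    rw [← map_mul, Matrix.mul_fin_two] at h1
    convert h1 using 2
    refine Matrix.fin_two_congr ?_ ?_ ?_ ?_ <;> field_simp <;> grind
  · have h1 := mul_mem (mul_mem (hE' ((a - 1) / c)) (hF' c)) (hE' ((d - 1) / c))
    rw [← map_mul, ← map_mul, Matrix.mul_fin_two, Matrix.mul_fin_two] at h1
    convert h1 using 2
    refine Matrix.fin_two_congr ?_ ?_ ?_ ?_ <;> field_simp <;> grind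

/-- Up to conjugation by a matrix congruent to `1`, the group `G` contains `GL_2^D(k)`. -/
theorem exists_conj_contains (h : HasFullReduction π D G)
    (hπ : ∀ x y, π x = 0 → π y = 0 → x * y = 0) :
    ∃ u : GL (Fin 2) T, Matrix.GeneralLinearGroup.map (π : T →+* k) u = 1 ∧
      ∀ γ ∈ GLTwoDet D k, Matrix.GeneralLinearGroup.map (algebraMap k T) γ ∈
        G.map (MulAut.conj u).toMonoidHom := by
  obtain ⟨u, hu, hut⟩ := h.exists_conj_torus hπ hk
  have h' := h.conj u hu
  obtain ⟨v, hv, hvt, x, hx, hX⟩ := h'.exists_conj_unipotent hk hπ hut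
  have h'' := h'.conj v hv
  have hmap : (G.map (MulAut.conj u).toMonoidHom).map (MulAut.conj v).toMonoidHom =
      G.map (MulAut.conj (v * u)).toMonoidHom := by
    rw [Subgroup.map_map, map_mul]
    rfl
  have hE := upper_mem hk hπ hvt hx hX
  have hF := h''.lower_mem hk hπ hvt hE
  refine ⟨v * u, by rw [map_mul, hu, hv, mul_one], fun γ hγ => ?_⟩
  rw [← hmap, ← coe_mem_matricesOf]
  rw [mem_GLTwoDet_self] at hγ
  -- Dividing γ by the scalar δ with δ² = det γ reduces to determinant one.
  obtain ⟨δ, hδ, hδ2⟩ := exists_mem_sq_eq D hγ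
  have hdet : (γ : Matrix (Fin 2) (Fin 2) k).det = (δ : k) ^ 2 := by
    rw [← Units.val_pow_eq_pow_val, hδ2]; rfl
  have h1 := det_one_mem hvt hE hF (γ := ((δ⁻¹ : kˣ) : k) • (γ : Matrix (Fin 2) (Fin 2) k)) (by
    rw [Matrix.det_smul, hdet, Fintype.card_fin, ← mul_pow, Units.inv_mul, one_pow])
  have h2 := mul_mem (h''.scalar_mem hπ hδ) h1
  convert h2 using 1
  have h3 : !![algebraMap k T δ, 0; 0, algebraMap k T δ] =
      (algebraMap k T).mapMatrix ((δ : k) • (1 : Matrix (Fin 2) (Fin 2) k)) := by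
    rw [Matrix.eta_fin_two ((algebraMap k T).mapMatrix _)]
    simp
  rw [h3, ← map_mul, smul_mul_smul_comm, one_mul, Units.mul_inv, one_smul]
  rfl

end HasFullReduction
end Conjugation

/-! ### The structure of the submodules of M_2^0(𝔪) -/

theorem exists_complement_family {F V : Type*} [Field F] [AddCommGroup V] [Module F V]
    [FiniteDimensional F V] {W S : Submodule F V} (hWS : W ≤ S) :
    ∃ (n : ℕ) (s : Fin n → V), (∀ j, s j ∈ S) ∧
      (∀ x ∈ S, ∃ w ∈ W, ∃ c : Fin n → F, x = w + ∑ j, c j • s j) ∧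
      (∀ c : Fin n → F, ∑ j, c j • s j ∈ W → c = 0) := by
  obtain ⟨C, hC⟩ := Submodule.exists_isCompl W
  let b := Module.finBasis F (C ⊓ S : Submodule F V)
  have hb : ∀ c : Fin _ → F, ∑ j, c j • (b j : V) = ((∑ j, c j • b j : (C ⊓ S : Submodule F V)) : V) := by
    intro c
    simp
  refine ⟨_, fun j => b j, fun j => (b j).2.2, fun x hx => ?_, fun c hc => ?_⟩
  -- Modular law, using W ≤ S.
  · have hS : W ⊔ (C ⊓ S) = S := by
      rw [← sup_inf_assoc_of_le _ hWS, hC.sup_eq_top, top_inf_eq]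
    rw [← hS] at hx
    obtain ⟨w, hw, y, hy, rfl⟩ := Submodule.mem_sup.1 hx
    refine ⟨w, hw, b.repr ⟨y, hy⟩, ?_⟩
    rw [hb, b.sum_repr]
  · rw [hb] at hc
    have h0 : ((∑ j, c j • b j : (C ⊓ S : Submodule F V)) : V) = 0 :=
      Submodule.disjoint_def.1 hC.disjoint _ hc (∑ j, c j • b j : (C ⊓ S : Submodule F V)).2.1
    have := Fintype.linearIndependent_iff.1 b.linearIndependent c (Subtype.ext h0)
    exact funext this

section Structure

variable {k T : Type*} [Field k] [CommRing T] [Algebra k T]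

/-- The embedding of the prime field of a field of characteristic two. -/
abbrev primeFieldHom (k : Type*) [Field k] [CharP k 2] : ZMod 2 →+* k :=
  ZMod.castHom (dvd_refl 2) k

namespace ConjSubmodule

variable {D : Subgroup kˣ} {π : T →ₐ[k] k}

section
variable [Finite k] [CharP k 2]

/-- The off-diagonal entries of the elements of a submodule. -/
def offDiag (M : ConjSubmodule D T) (hk : 2 < Nat.card k) : Submodule k T where
  carrier := {w | !![0, w; 0, 0] ∈ M.toAddSubgroup}
  zero_mem' := by
    change !![0, 0; 0, 0] ∈ M.toAddSubgroup
    convert M.toAddSubgroup.zero_mem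
    ext i j
    fin_cases i <;> fin_cases j <;> rfl
  add_mem' := fun {a b} ha hb => by
    change !![0, a + b; 0, 0] ∈ M.toAddSubgroup
    have := add_mem_fin_two (M := M) ha hb
    rwa [add_zero] at this
  smul_mem' := fun r w hw => by
    change !![0, r • w; 0, 0] ∈ M.toAddSubgroup
    rw [Algebra.smul_def]
    exact upper_mem_of_lower_entry hk (swap_mem hw) r

end

/-- The scalars in a submodule. -/
def scalarPart (M : ConjSubmodule D T) : AddSubgroup T where
  carrier := {x | !![x, 0; 0, x] ∈ M.toAddSubgroup}
  zero_mem' := by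
    change !![0, 0; 0, 0] ∈ M.toAddSubgroup
    convert M.toAddSubgroup.zero_mem
    ext i j
    fin_cases i <;> fin_cases j <;> rfl
  add_mem' := fun {a b} ha hb => by
    change !![a + b, 0; 0, a + b] ∈ M.toAddSubgroup
    have := add_mem_fin_two (M := M) ha hb
    rwa [add_zero] at this
  neg_mem' := fun {a} ha => by
    change !![-a, 0; 0, -a] ∈ M.toAddSubgroup
    have := M.toAddSubgroup.neg_mem ha
    simpa using this

variable [Finite k] [CharP k 2] (hk : 2 < Nat.card k) {M : ConjSubmodule D T}

omit [Finite k] [CharP k 2] in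
theorem mem_scalarPart {x : T} : x ∈ M.scalarPart ↔ !![x, 0; 0, x] ∈ M.toAddSubgroup := Iff.rfl

/-- In characteristic 2 an off-diagonal entry produces a scalar, but not conversely: the quotient of
the two groups accounts for the C_2 summands. -/
theorem offDiag_le_scalarPart : (M.offDiag hk).toAddSubgroup ≤ M.scalarPart := by
  intro w hw
  have := scalar_mem_of_lower_entry hk (swap_mem hw) 1
  rwa [map_one, one_mul] at this

/-- Each off-diagonal entry can be split off inside M, and what remains is scalar. So M is known
once its off-diagonal space and its scalar group are. -/
theorem fin_two_mem_iff {x b c : T} : !![x, b; c, x] ∈ M.toAddSubgroup ↔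
    x ∈ M.scalarPart ∧ b ∈ M.offDiag hk ∧ c ∈ M.offDiag hk := by
  have e : (2 : T) = 0 := two_eq_zero_of_algebra k
  constructor
  · intro h
    have hc := upper_mem_of_lower_entry hk h 1
    have hb := upper_mem_of_lower_entry hk (swap_mem h) 1
    rw [map_one, one_mul] at hb hc
    refine ⟨?_, hb, hc⟩
    have h1 := add_mem_fin_two (add_mem_fin_two h hb) (swap_mem hc)
    rw [mem_scalarPart]
    convert h1 using 1
    refine Matrix.fin_two_congr ?_ ?_ ?_ ?_ <;> grind
  · rintro ⟨hx, hb, hc⟩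
    have h1 := add_mem_fin_two (add_mem_fin_two hx hb) (swap_mem hc)
    convert h1 using 1
    refine Matrix.fin_two_congr ?_ ?_ ?_ ?_ <;> grind

variable (hM : M.toAddSubgroup ≤ (traceZero D (RingHom.ker π)).toAddSubgroup)

omit [Finite k] in
theorem eq_fin_two_of_trace_eq_zero {R : Type*} [CommRing R] [Algebra k R]
    {A : Matrix (Fin 2) (Fin 2) R} (hA : A.trace = 0) :
    A = !![A 0 0, A 0 1; A 1 0, A 0 0] := by
  have e : (2 : R) = 0 := two_eq_zero_of_algebra k
  rw [Matrix.trace_fin_two] at hA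
  conv_lhs => rw [Matrix.eta_fin_two A]
  exact Matrix.fin_two_congr rfl rfl rfl (by linear_combination hA - A 0 0 * e)

include hM in
theorem mem_iff_entries {A : Matrix (Fin 2) (Fin 2) T} : A ∈ M.toAddSubgroup ↔
    A.trace = 0 ∧ A 0 0 ∈ M.scalarPart ∧ A 0 1 ∈ M.offDiag hk ∧ A 1 0 ∈ M.offDiag hk := by
  constructor
  · intro h
    have ht := (hM h).1
    rw [eq_fin_two_of_trace_eq_zero (k := k) ht] at h
    exact ⟨ht, (fin_two_mem_iff hk).1 h⟩
  · rintro ⟨ht, h⟩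
    rw [eq_fin_two_of_trace_eq_zero (k := k) ht]
    exact (fin_two_mem_iff hk).2 h

include hM

omit [Finite k] [CharP k 2] in
theorem scalarPart_le {x : T} (hx : x ∈ M.scalarPart) : π x = 0 := (hM hx).2 0 0

omit hM in
/-- A family of scalars that spans a complement of the off-diagonal entries. -/
theorem exists_scalar_family [Nontrivial T] [Module.Finite k T] :
    ∃ (n : ℕ) (s : Fin n → T), (∀ j, s j ∈ M.scalarPart) ∧
      (∀ x ∈ M.scalarPart, ∃ w ∈ M.offDiag hk, ∃ c : Fin n → ZMod 2,
        x = w + ∑ j, algebraMap k T (primeFieldHom k (c j)) * s j) ∧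
      (∀ c : Fin n → ZMod 2, ∑ j, algebraMap k T (primeFieldHom k (c j)) * s j ∈ M.offDiag hk →
        c = 0) := by
  have : CharP T 2 := charP_of_injective_algebraMap (algebraMap k T).injective 2
  let : Algebra (ZMod 2) T := ZMod.algebra T 2
  have : Finite T := Module.finite_of_finite k
  have h : AddSubgroup.toZModSubmodule 2 (M.offDiag hk).toAddSubgroup ≤
      AddSubgroup.toZModSubmodule 2 M.scalarPart := offDiag_le_scalarPart hk
  obtain ⟨n, s, h1, h2, h3⟩ := exists_complement_family h
  have key : ∀ (c : ZMod 2) (x : T), c • x = algebraMap k T (primeFieldHom k c) * x := by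
    intro c x
    rw [Algebra.smul_def]
    congr 1
    exact RingHom.congr_fun (Subsingleton.elim (algebraMap (ZMod 2) T)
      ((algebraMap k T).comp (primeFieldHom k))) c
  simp only [key] at h2 h3
  exact ⟨n, s, h1, h2, h3⟩

omit [Finite k] [CharP k 2] hM in
theorem exists_smul_one_of_mem_scalarCyclic [CharP k 2] (c : ScalarCTwo D) :
    ∃ n : ZMod 2, c.1 = primeFieldHom k n • (1 : Matrix (Fin 2) (Fin 2) k) := by
  obtain ⟨n, hn⟩ := AddSubgroup.mem_zmultiples_iff.1 c.2
  refine ⟨(n : ZMod 2), hn.symm.trans ?_⟩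
  rw [map_intCast, Int.cast_smul_eq_zsmul]

omit [Finite k] hM in
theorem smul_one_mem_scalarCyclic (n : ZMod 2) :
    primeFieldHom k n • (1 : Matrix (Fin 2) (Fin 2) k) ∈ (scalarCyclic D).toAddSubgroup := by
  obtain ⟨n, rfl⟩ := ZMod.intCast_surjective n
  rw [map_intCast, Int.cast_smul_eq_zsmul]
  exact AddSubgroup.mem_zmultiples_iff.2 ⟨n, rfl⟩

/-- A k-basis (b_i) of W and the family (s_j) completing W to S give the equivariant map (v, c) ↦ Σ
b_i v_i + Σ s_j c_j. Off-diagonal entries see only v. The diagonal entry determines c by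
independence modulo W, and then the diagonals of v. -/
theorem exists_equiv [Module.Finite k T] {n : ℕ} {s : Fin n → T}
    (h1 : ∀ j, s j ∈ M.scalarPart)
    (h2 : ∀ x ∈ M.scalarPart, ∃ w ∈ M.offDiag hk, ∃ c : Fin n → ZMod 2,
        x = w + ∑ j, algebraMap k T (primeFieldHom k (c j)) * s j)
    (h3 : ∀ c : Fin n → ZMod 2, ∑ j, algebraMap k T (primeFieldHom k (c j)) * s j ∈ M.offDiag hk →
        c = 0) :
    ∃ f : M.Elem ≃+ (Fin (Module.finrank k (M.offDiag hk)) → TraceZero D) ×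
        (Fin n → ScalarCTwo D),
      ∀ (g : GLTwoDet D k) (x : M.Elem), f (g • x) = g • f x := by
  let b := Module.finBasis k (M.offDiag hk)
  let F : (Fin (Module.finrank k (M.offDiag hk)) → TraceZero D) × (Fin n → ScalarCTwo D) →
      Matrix (Fin 2) (Fin 2) T := fun p =>
    ∑ i, (b i : T) • (algebraMap k T).mapMatrix (p.1 i).1 +
      ∑ j, s j • (algebraMap k T).mapMatrix (p.2 j).1
  have hentry : ∀ p i' j', F p i' j' = ∑ i, algebraMap k T ((p.1 i).1 i' j') * (b i : T) +
      ∑ j, algebraMap k T ((p.2 j).1 i' j') * s j := by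
    intro p i' j'
    simp [F, Matrix.add_apply, Matrix.sum_apply, mul_comm]
  have hW : ∀ a : Fin _ → k, ∑ i, algebraMap k T (a i) * (b i : T) =
      ((∑ i, a i • b i : M.offDiag hk) : T) := by
    intro a
    simp [Algebra.smul_def]
  have hoff : ∀ (c : ScalarCTwo D) (i j : Fin 2), i ≠ j → c.1 i j = 0 := by
    intro c i j hij
    obtain ⟨m, hm⟩ := exists_smul_one_of_mem_scalarCyclic c
    rw [hm, Matrix.smul_apply, Matrix.one_apply_ne hij, smul_zero]
  have hoffsum : ∀ p i' j', i' ≠ j' →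
      F p i' j' = ((∑ i, (p.1 i).1 i' j' • b i : M.offDiag hk) : T) := by
    intro p i' j' hij
    rw [hentry, hW, Finset.sum_eq_zero (s := (Finset.univ : Finset (Fin n))), add_zero]
    intro j _
    rw [hoff _ _ _ hij, map_zero, zero_mul]
  have hFmem : ∀ p, F p ∈ M.toAddSubgroup := by
    intro p
    refine M.toAddSubgroup.add_mem (M.toAddSubgroup.sum_mem fun i _ => ?_)
      (M.toAddSubgroup.sum_mem fun j _ => ?_)
    · rw [mem_iff_entries hk hM]
      have hv := (p.1 i).2.1
      have hmem : ∀ r : k, (b i : T) * algebraMap k T r ∈ M.offDiag hk := fun r => by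
        rw [mul_comm, ← Algebra.smul_def]
        exact Submodule.smul_mem _ _ (b i).2
      refine ⟨?_, offDiag_le_scalarPart hk (hmem _), hmem _, hmem _⟩
      rw [Matrix.trace_smul]
      have : ((algebraMap k T).mapMatrix (p.1 i).1).trace = algebraMap k T (p.1 i).1.trace :=
        by
        rw [Matrix.trace_fin_two, Matrix.trace_fin_two, map_add]; rfl
      rw [this, hv, map_zero, smul_zero]
    · obtain ⟨m, hm⟩ := exists_smul_one_of_mem_scalarCyclic (p.2 j)
      rw [hm]
      obtain ⟨m, rfl⟩ := ZMod.intCast_surjective m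
      rw [map_intCast, Int.cast_smul_eq_zsmul, map_zsmul, map_one, smul_comm]
      refine M.toAddSubgroup.zsmul_mem ?_ _
      have := h1 j
      rw [mem_scalarPart] at this
      convert this using 1
      rw [Matrix.one_fin_two]
      simp
  have hFadd : ∀ p p', F (p + p') = F p + F p' := by
    intro p p'
    ext i' j'
    rw [Matrix.add_apply, hentry, hentry, hentry, add_add_add_comm, ← Finset.sum_add_distrib,
      ← Finset.sum_add_distrib]
    congr 1
    · refine Finset.sum_congr rfl fun i _ => ?_
      rw [← add_mul, ← map_add]; rfl
    · refine Finset.sum_congr rfl fun i _ => ?_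
      rw [← add_mul, ← map_add]; rfl
  let φ : (Fin (Module.finrank k (M.offDiag hk)) → TraceZero D) × (Fin n → ScalarCTwo D) →+
      M.Elem := AddMonoidHom.mk' (fun p => (⟨F p, hFmem p⟩ : M.toAddSubgroup))
        fun p p' => Subtype.ext (hFadd p p')
  have hφ : Function.Bijective φ := by
    constructor
    · rw [injective_iff_map_eq_zero]
      intro p hp
      have hp' : F p = 0 := congrArg Subtype.val hp
      have hzero : ∀ i' j', i' ≠ j' → ∀ i, (p.1 i).1 i' j' = 0 := by
        intro i' j' hij
        have h4 := hoffsum p i' j' hij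
        rw [hp'] at h4
        exact Fintype.linearIndependent_iff.1 b.linearIndependent _ (Subtype.ext h4.symm)
      choose c hc using fun j => exists_smul_one_of_mem_scalarCyclic (p.2 j)
      have hc00 : ∀ j, (p.2 j).1 0 0 = primeFieldHom k (c j) := fun j => by
        rw [hc]; simp
      have h4 := hentry p 0 0
      rw [hp', hW] at h4
      simp only [hc00] at h4
      have h5 : c = 0 := by
        refine h3 c ?_
        rw [← sub_eq_iff_eq_add'.2 h4, Matrix.zero_apply, zero_sub]
        exact neg_mem (Subtype.mem _)
      have h6 : ∀ i, (p.1 i).1 0 0 = 0 := by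
        refine Fintype.linearIndependent_iff.1 b.linearIndependent _ (Subtype.ext ?_)
        rw [h5] at h4
        simpa using h4.symm
      refine Prod.ext (funext fun i => Subtype.ext ?_) (funext fun j => Subtype.ext ?_)
      · rw [eq_fin_two_of_trace_eq_zero (k := k) (p.1 i).2.1, h6, hzero _ _ zero_ne_one,
          hzero _ _ one_ne_zero]
        ext i' j'
        fin_cases i' <;> fin_cases j' <;> rfl
      · rw [hc, h5, Pi.zero_apply, map_zero, zero_smul]
        rfl
    · rintro ⟨A, hA⟩
      obtain ⟨ht, h00, h01, h10⟩ := (mem_iff_entries hk hM).1 hA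
      obtain ⟨w, hw, c, hx⟩ := h2 _ h00
      let v : Fin _ → TraceZero D := fun i =>
        (⟨!![b.repr ⟨w, hw⟩ i, b.repr ⟨_, h01⟩ i; b.repr ⟨_, h10⟩ i, b.repr ⟨w, hw⟩ i], by
          rw [Matrix.trace_fin_two]
          exact CharTwo.add_self_eq_zero _, fun _ _ => Submodule.mem_top⟩ :
          (traceZero D (⊤ : Ideal k)).toAddSubgroup)
      let cc : Fin n → ScalarCTwo D := fun j =>
        (⟨_, smul_one_mem_scalarCyclic (c j)⟩ : (scalarCyclic D).toAddSubgroup)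
      refine ⟨(v, cc), Subtype.ext ?_⟩
      change F (v, cc) = A
      rw [eq_fin_two_of_trace_eq_zero (k := k) ht,
        eq_fin_two_of_trace_eq_zero (k := k) (hM (hFmem (v, cc))).1]
      refine Matrix.fin_two_congr ?_ ?_ ?_ ?_
      · rw [hentry, hx, hW]
        congr 1
        · exact congrArg Subtype.val (b.sum_repr ⟨w, hw⟩)
        · refine Finset.sum_congr rfl fun j _ => ?_
          congr 2
          change (primeFieldHom k (c j) • (1 : Matrix (Fin 2) (Fin 2) k)) 0 0 = _
          simp
      · rw [hoffsum _ _ _ zero_ne_one]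
        exact congrArg Subtype.val (b.sum_repr ⟨_, h01⟩)
      · rw [hoffsum _ _ _ one_ne_zero]
        exact congrArg Subtype.val (b.sum_repr ⟨_, h10⟩)
      · rw [hentry, hx, hW]
        congr 1
        · exact congrArg Subtype.val (b.sum_repr ⟨w, hw⟩)
        · refine Finset.sum_congr rfl fun j _ => ?_
          congr 2
          change (primeFieldHom k (c j) • (1 : Matrix (Fin 2) (Fin 2) k)) 0 0 = _
          simp
  have hequiv : ∀ (g : GLTwoDet D k) p, φ (g • p) = g • φ p := by
    intro g p
    refine Subtype.ext ?_
    change F (g • p) = (algebraMap k T).mapMatrix (g.1 : Matrix (Fin 2) (Fin 2) k) * F p *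
      (algebraMap k T).mapMatrix ((g.1⁻¹ : GL (Fin 2) k) : Matrix (Fin 2) (Fin 2) k)
    have hsm : ∀ B : Matrix (Fin 2) (Fin 2) k,
        (algebraMap k T).mapMatrix ((algebraMap k k).mapMatrix (g.1 : Matrix (Fin 2) (Fin 2) k) *
          B * (algebraMap k k).mapMatrix ((g.1⁻¹ : GL (Fin 2) k) : Matrix (Fin 2) (Fin 2) k)) =
        (algebraMap k T).mapMatrix (g.1 : Matrix (Fin 2) (Fin 2) k) *
          (algebraMap k T).mapMatrix B *
          (algebraMap k T).mapMatrix ((g.1⁻¹ : GL (Fin 2) k) : Matrix (Fin 2) (Fin 2) k) := by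
      intro B
      rw [map_mul, map_mul]
      rfl
    simp only [F, mul_add, add_mul, Finset.mul_sum, Finset.sum_mul, mul_smul_comm, smul_mul_assoc]
    congr 1
    · exact Finset.sum_congr rfl fun i _ => congrArg _ (hsm (p.1 i).1)
    · exact Finset.sum_congr rfl fun i _ => congrArg _ (hsm (p.2 i).1)
  let e := AddEquiv.ofBijective φ hφ
  refine ⟨e.symm, fun g x => ?_⟩
  rw [AddEquiv.symm_apply_eq]
  change _ = φ (g • e.symm x)
  rw [hequiv]
  exact congrArg _ (e.apply_symm_apply x).symm

end ConjSubmodule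
end Structure

/-! ### Cardinalities and the number of traces -/

section Count

variable {k T : Type*} [Field k] [CommRing T] [Algebra k T]

namespace ConjSubmodule

variable {D : Subgroup kˣ} {π : T →ₐ[k] k} [Finite k] [CharP k 2] (hk : 2 < Nat.card k)
  {M : ConjSubmodule D T}

theorem card_scalarPart [Module.Finite k T] {n : ℕ} {s : Fin n → T}
    (h1 : ∀ j, s j ∈ M.scalarPart)
    (h2 : ∀ x ∈ M.scalarPart, ∃ w ∈ M.offDiag hk, ∃ c : Fin n → ZMod 2,
        x = w + ∑ j, algebraMap k T (primeFieldHom k (c j)) * s j)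
    (h3 : ∀ c : Fin n → ZMod 2, ∑ j, algebraMap k T (primeFieldHom k (c j)) * s j ∈ M.offDiag hk →
        c = 0) :
    Nat.card M.scalarPart = Nat.card (M.offDiag hk) * 2 ^ n := by
  have hsum : ∀ c : Fin n → ZMod 2,
      ∑ j, algebraMap k T (primeFieldHom k (c j)) * s j ∈ M.scalarPart := by
    intro c
    refine M.scalarPart.sum_mem fun j _ => ?_
    obtain ⟨m, hm⟩ := ZMod.intCast_surjective (c j)
    rw [← hm, map_intCast, map_intCast, ← zsmul_eq_mul]
    exact M.scalarPart.zsmul_mem (h1 j) _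
  let F : M.offDiag hk × (Fin n → ZMod 2) → M.scalarPart := fun p =>
    ⟨(p.1 : T) + ∑ j, algebraMap k T (primeFieldHom k (p.2 j)) * s j,
      M.scalarPart.add_mem (offDiag_le_scalarPart hk p.1.2) (hsum p.2)⟩
  have hF : Function.Bijective F := by
    constructor
    · rintro ⟨w, c⟩ ⟨w', c'⟩ h
      have h4 : (w : T) + ∑ j, algebraMap k T (primeFieldHom k (c j)) * s j =
        w' + ∑ j, algebraMap k T (primeFieldHom k (c' j)) * s j := congrArg Subtype.val h
      have h5 : c = c' := by
        rw [← sub_eq_zero]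
        refine h3 _ ?_
        have : ∑ j, algebraMap k T (primeFieldHom k ((c - c') j)) * s j = ((w' - w :
            M.offDiag hk) : T) := by
          simp only [Pi.sub_apply, map_sub, sub_mul, Finset.sum_sub_distrib]
          rw [Submodule.coe_sub]
          linear_combination h4
        rw [this]
        exact Subtype.mem _
      subst h5
      have h6 : w = w' := Subtype.ext (add_right_cancel h4)
      rw [h6]
    · rintro ⟨x, hx⟩
      obtain ⟨w, hw, c, rfl⟩ := h2 x hx
      exact ⟨(⟨w, hw⟩, c), rfl⟩
  rw [← Nat.card_eq_of_bijective F hF, Nat.card_prod, Nat.card_fun]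
  simp

theorem card_offDiag [Module.Finite k T] :
    Nat.card (M.offDiag hk) = Nat.card k ^ Module.finrank k (M.offDiag hk) :=
  Module.natCard_eq_pow_finrank

variable (hM : M.toAddSubgroup ≤ (traceZero D (RingHom.ker π)).toAddSubgroup)
include hM

theorem offDiag_le {w : T} (hw : w ∈ M.offDiag hk) : π w = 0 :=
  scalarPart_le hM (offDiag_le_scalarPart hk hw)

theorem finrank_offDiag_le [Module.Finite k T] :
    Module.finrank k (M.offDiag hk) ≤ Module.finrank k (RingHom.ker π) := by
  have h : M.offDiag hk ≤ (RingHom.ker π).restrictScalars k := fun w hw => offDiag_le hk hM hw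
  exact Submodule.finrank_mono h

/-- The scalar group lies in 𝔪; compare the exponents of 2 in the two orders. -/
theorem complement_card_le [Module.Finite k T] {d n : ℕ} (hd : Nat.card k = 2 ^ d)
    (hn : Nat.card M.scalarPart = Nat.card (M.offDiag hk) * 2 ^ n) :
    n ≤ d * (Module.finrank k (RingHom.ker π) - Module.finrank k (M.offDiag hk)) := by
  have : Finite T := Module.finite_of_finite k
  have h : Nat.card M.scalarPart ≤ Nat.card (RingHom.ker π) :=
    Nat.card_mono (Set.toFinite _) (fun x hx => scalarPart_le hM hx :
      (M.scalarPart : Set T) ⊆ (RingHom.ker π : Set T))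
  have h2 : Nat.card (RingHom.ker π) = Nat.card k ^ Module.finrank k (RingHom.ker π) :=
    Module.natCard_eq_pow_finrank
  rw [hn, h2, card_offDiag, hd, ← pow_mul, ← pow_mul, ← pow_add,
    Nat.pow_le_pow_iff_right one_lt_two] at h
  rw [Nat.mul_sub]
  omega

/-- The trace of (1 + A)γ is (1 + A₀₀) tr γ plus an element of W. For tr γ = 0 it lies in W. For tr
γ = λ ≠ 0 the W-term is absorbed into the scalar, giving λ(1 + x) with x ∈ S. Reduction modulo 𝔪
recovers λ, so the two kinds are disjoint and the second is parametrised injectively by kˣ × S. -/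
theorem ncard_traces [Module.Finite k T] {d n : ℕ} (hd : Nat.card k = 2 ^ d)
    (hn : Nat.card M.scalarPart = Nat.card (M.offDiag hk) * 2 ^ n) :
    {t | ∃ A ∈ M.toAddSubgroup, ∃ γ ∈ GLTwoDet D k,
      t = ((1 + A) * (algebraMap k T).mapMatrix (γ : Matrix (Fin 2) (Fin 2) k)).trace}.ncard =
    (2 ^ d) ^ Module.finrank k (M.offDiag hk) * ((2 ^ d - 1) * 2 ^ n + 1) := by
  have : Finite T := Module.finite_of_finite k
  have e : (2 : T) = 0 := two_eq_zero_of_algebra k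
  let F : kˣ × M.scalarPart → T := fun p => algebraMap k T p.1 * (1 + p.2)
  have hFπ : ∀ p, π (F p) = p.1 := by
    intro p
    simp only [F]
    rw [map_mul, AlgHom.commutes, map_add, map_one, scalarPart_le hM p.2.2, add_zero, mul_one]
    rfl
  have hFinj : Function.Injective F := by
    rintro ⟨l, x⟩ ⟨l', x'⟩ h
    have h1 : l = l' := Units.ext (by rw [← hFπ (l, x), h, hFπ])
    subst h1
    have h2 : (1 : T) + x = 1 + x' := by
      have := congrArg (algebraMap k T (l⁻¹ : kˣ) * ·) h
      simpa only [F, ← mul_assoc, ← map_mul, Units.inv_mul, map_one, one_mul] using this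
    exact Prod.ext rfl (Subtype.ext (add_left_cancel h2))
  have hset : {t | ∃ A ∈ M.toAddSubgroup, ∃ γ ∈ GLTwoDet D k,
      t = ((1 + A) * (algebraMap k T).mapMatrix (γ : Matrix (Fin 2) (Fin 2) k)).trace} =
      (M.offDiag hk : Set T) ∪ Set.range F := by
    have htr : ∀ (A : Matrix (Fin 2) (Fin 2) T) (γ : Matrix (Fin 2) (Fin 2) k), A.trace = 0 →
        ((1 + A) * (algebraMap k T).mapMatrix γ).trace =
          (1 + A 0 0) * algebraMap k T (γ 0 0 + γ 1 1) +
            (algebraMap k T (γ 1 0) * A 0 1 + algebraMap k T (γ 0 1) * A 1 0) := by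
      intro A γ hA
      rw [eq_fin_two_of_trace_eq_zero (k := k) hA, Matrix.one_fin_two, Matrix.trace_fin_two,
        Matrix.mul_apply, Matrix.mul_apply]
      simp
      ring
    ext t
    constructor
    · rintro ⟨A, hA, γ, -, rfl⟩
      obtain ⟨hA0, h00, h01, h10⟩ := (mem_iff_entries hk hM).1 hA
      rw [htr _ _ hA0]
      have hw : algebraMap k T (γ 1 0) * A 0 1 + algebraMap k T (γ 0 1) * A 1 0 ∈
          M.offDiag hk := by
        rw [← Algebra.smul_def, ← Algebra.smul_def]
        exact add_mem (Submodule.smul_mem _ _ h01) (Submodule.smul_mem _ _ h10)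
      generalize algebraMap k T (γ 1 0) * A 0 1 + algebraMap k T (γ 0 1) * A 1 0 = w at hw
      by_cases hl : γ 0 0 + γ 1 1 = 0
      · left
        rw [hl, map_zero, mul_zero, zero_add]
        exact hw
      · right
        generalize γ 0 0 + γ 1 1 = l at hl
        have hw' : algebraMap k T l⁻¹ * w ∈ M.offDiag hk := by
          rw [← Algebra.smul_def]
          exact Submodule.smul_mem _ _ hw
        refine ⟨(Units.mk0 l hl, ⟨_, add_mem h00 (offDiag_le_scalarPart hk hw')⟩), ?_⟩
        have hl' : algebraMap k T l * algebraMap k T l⁻¹ = 1 := by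
          rw [← map_mul, mul_inv_cancel₀ hl, map_one]
        change algebraMap k T l * (1 + (A 0 0 + algebraMap k T l⁻¹ * w)) = _
        linear_combination w * hl'
    -- Matrices of determinant -1 = 1 and of trace 0 or l realise every value, whatever D is.
    · rintro (hw | ⟨⟨l, x, hx⟩, rfl⟩)
      · refine ⟨_, hw, _, (GLTwoDet.ofDetOne D !![0, 1; 1, 0]
          (by simp [Matrix.det_fin_two, CharTwo.neg_eq])).2, ?_⟩
        rw [htr _ _ (hM hw).1]
        simp [GLTwoDet.ofDetOne]
      · refine ⟨_, hx, _, (GLTwoDet.ofDetOne D !![(l : k), 1; 1, 0]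
          (by simp [Matrix.det_fin_two, CharTwo.neg_eq])).2, ?_⟩
        rw [htr _ _ (hM hx).1]
        simp [GLTwoDet.ofDetOne, F, mul_comm]
  have hdisj : Disjoint (M.offDiag hk : Set T) (Set.range F) := by
    rw [Set.disjoint_left]
    rintro _ hw ⟨p, rfl⟩
    exact p.1.ne_zero (by rw [← hFπ, offDiag_le hk hM hw])
  have h1 : (M.offDiag hk : Set T).ncard = Nat.card (M.offDiag hk) := rfl
  have h2 : (Set.range F).ncard = Nat.card (kˣ × M.scalarPart) :=
    Nat.card_congr (Equiv.ofInjective F hFinj).symm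
  rw [hset, Set.ncard_union_eq hdisj, h1, h2, Nat.card_prod, Nat.card_units, hn, card_offDiag, hd]
  ring

end ConjSubmodule
end Count

/-! ### Galois correspondence, and extensions cut out by a cocycle -/

theorem MulEquiv.exists_of_surjective_of_ker_eq {G H H' : Type*} [Group G] [Group H] [Group H']
    {f : G →* H} {g : G →* H'} (hf : Function.Surjective f) (hg : Function.Surjective g)
    (h : f.ker = g.ker) : ∃ e : H ≃* H', ∀ x, e (f x) = g x := by
  refine ⟨(QuotientGroup.liftEquiv f.ker hf rfl).symm.trans (QuotientGroup.liftEquiv f.ker hg h),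
    fun x => ?_⟩
  have : (QuotientGroup.liftEquiv f.ker hf rfl).symm (f x) = (x : G ⧸ f.ker) := by
    rw [MulEquiv.symm_apply_eq]; rfl
  rw [MulEquiv.trans_apply, this]
  rfl

/-- A field carries at most one ℚ-algebra structure, but two constructions of it need not be
definitionally equal. -/
theorem isGalois_rat_congr {F : Type*} [Field F] (i j : Algebra ℚ F)
    (h : @IsGalois ℚ _ F _ i) : @IsGalois ℚ _ F _ j := by
  rwa [Subsingleton.elim j i]

instance isGalois_algebraicClosure_rat : IsGalois ℚ (AlgebraicClosure ℚ) :=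
  isGalois_rat_congr _ _ (inferInstance :
    @IsGalois ℚ _ (AlgebraicClosure ℚ) _ (AlgebraicClosure.instAlgebra ℚ))

section Galois

variable {Ω : Type*} [Field Ω] [Algebra ℚ Ω] [IsGalois ℚ Ω]

theorem exists_intermediateField_of_isOpen (N : Subgroup Gal(Ω/ℚ)) [N.Normal]
    (hN : IsOpen (N : Set Gal(Ω/ℚ))) :
    ∃ F : IntermediateField ℚ Ω, F.fixingSubgroup = N ∧ FiniteDimensional ℚ F ∧ IsGalois ℚ F := by
  have h := InfiniteGalois.fixingSubgroup_fixedField (K := Ω) (k := ℚ)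
    ⟨N, N.isClosed_of_isOpen hN⟩
  refine ⟨IntermediateField.fixedField N, h, ?_, ?_⟩
  · rw [← InfiniteGalois.isOpen_iff_finite]
    change IsOpen ((IntermediateField.fixedField N).fixingSubgroup : Set Gal(Ω/ℚ))
    rw [h]
    exact hN
  · refine isGalois_rat_congr _ _ ((InfiniteGalois.normal_iff_isGalois _).1 ?_)
    rw [h]
    assumption

variable {K : IntermediateField ℚ Ω}

theorem exists_intermediateField_over_of_isOpen (N : Subgroup Gal(Ω/ℚ)) [N.Normal]
    (hN : IsOpen (N : Set Gal(Ω/ℚ))) (hNK : N ≤ K.fixingSubgroup) :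
    ∃ L : IntermediateField K Ω, (L.restrictScalars ℚ).fixingSubgroup = N ∧
      FiniteDimensional ℚ L ∧ IsGalois ℚ L := by
  obtain ⟨F, hF, h1, h2⟩ := exists_intermediateField_of_isOpen N hN
  have hKF : K ≤ F := by
    rw [← InfiniteGalois.fixedField_fixingSubgroup F, IntermediateField.le_iff_le, hF]
    exact hNK
  exact ⟨IntermediateField.extendScalars hKF, hF, h1, h2⟩

/-- Restriction of automorphisms to a normal subextension. -/
theorem exists_restriction (L : IntermediateField K Ω) [IsGalois ℚ L] :
    ∃ r : Gal(Ω/ℚ) →* Gal(L/ℚ), Function.Surjective r ∧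
      (∀ σ (x : L), (r σ x : Ω) = σ x) ∧ r.ker = (L.restrictScalars ℚ).fixingSubgroup := by
  have hr : ∀ (σ : Gal(Ω/ℚ)) (x : L), ((AlgEquiv.restrictNormalHom (F := ℚ) L σ x : L) : Ω) = σ x :=
    fun σ x => AlgEquiv.restrictNormal_commutes σ L x
  refine ⟨AlgEquiv.restrictNormalHom (F := ℚ) L, AlgEquiv.restrictNormalHom_surjective Ω, hr, ?_⟩
  ext σ
  rw [MonoidHom.mem_ker, IntermediateField.mem_fixingSubgroup_iff]
  constructor
  · intro h x hx
    rw [← hr σ ⟨x, hx⟩, h]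
    rfl
  · intro h
    ext x
    rw [hr]
    exact h x x.2

theorem exists_restriction_base (K : IntermediateField ℚ Ω) [IsGalois ℚ K] :
    ∃ r : Gal(Ω/ℚ) →* Gal(K/ℚ), Function.Surjective r ∧
      (∀ σ (x : K), (r σ x : Ω) = σ x) ∧ r.ker = K.fixingSubgroup := by
  have hr : ∀ (σ : Gal(Ω/ℚ)) (x : K), ((AlgEquiv.restrictNormalHom (F := ℚ) K σ x : K) : Ω) = σ x :=
    fun σ x => AlgEquiv.restrictNormal_commutes σ K x
  refine ⟨AlgEquiv.restrictNormalHom (F := ℚ) K, AlgEquiv.restrictNormalHom_surjective Ω, hr, ?_⟩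
  ext σ
  rw [MonoidHom.mem_ker, IntermediateField.mem_fixingSubgroup_iff]
  constructor
  · intro h x hx
    rw [← hr σ ⟨x, hx⟩, h]
    rfl
  · intro h
    ext x
    rw [hr]
    exact h x x.2

theorem exists_relative_restriction (L : IntermediateField K Ω) [IsGalois ℚ L] :
    ∃ r : K.fixingSubgroup →* Gal(L/K), Function.Surjective r ∧
      (∀ σ (x : L), (r σ x : Ω) = σ.1 x) := by
  have : IsGalois K L := IsGalois.tower_top_of_isGalois ℚ K L
  have : IsGalois K Ω := IsGalois.tower_top_of_isGalois ℚ K Ω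
  refine ⟨(AlgEquiv.restrictNormalHom (F := K) L).comp
    (IntermediateField.fixingSubgroupEquiv K).toMonoidHom, ?_, ?_⟩
  · exact (AlgEquiv.restrictNormalHom_surjective Ω).comp
      (IntermediateField.fixingSubgroupEquiv K).surjective
  · exact fun σ x => AlgEquiv.restrictNormal_commutes
      (IntermediateField.fixingSubgroupEquiv K σ) L x

section Cocycle

variable {Γ A : Type*} [Group Γ] [AddCommGroup A] [DistribMulAction Γ A]
  {r : Gal(Ω/ℚ) →* Gal(K/ℚ)} {e : Gal(K/ℚ) →* Γ} {a : Gal(Ω/ℚ) → A}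

/-- The homomorphism to the semidirect product given by a cocycle. -/
def cocycleHom (r : Gal(Ω/ℚ) →* Gal(K/ℚ)) (e : Gal(K/ℚ) →* Γ) (a : Gal(Ω/ℚ) → A)
    (ha : ∀ σ τ, a (σ * τ) = a σ + e (r σ) • a τ) :
    Gal(Ω/ℚ) →* Multiplicative A ⋊[actionHom e A] Gal(K/ℚ) :=
  MonoidHom.mk' (fun σ => ⟨Multiplicative.ofAdd (a σ), r σ⟩) fun σ τ => by
    ext1
    · exact congrArg Multiplicative.ofAdd (ha σ τ)
    · exact map_mul r σ τ

omit [IsGalois ℚ Ω] in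
theorem mem_ker_cocycleHom (ha : ∀ σ τ, a (σ * τ) = a σ + e (r σ) • a τ) {σ : Gal(Ω/ℚ)} :
    σ ∈ (cocycleHom r e a ha).ker ↔ r σ = 1 ∧ a σ = 0 := by
  rw [MonoidHom.mem_ker, SemidirectProduct.ext_iff, and_comm]
  rfl

omit [IsGalois ℚ Ω] in
theorem cocycleHom_ker_le (hrker : r.ker = K.fixingSubgroup)
    (ha : ∀ σ τ, a (σ * τ) = a σ + e (r σ) • a τ) :
    (cocycleHom r e a ha).ker ≤ K.fixingSubgroup := fun _ hσ =>
  hrker ▸ MonoidHom.mem_ker.2 ((mem_ker_cocycleHom ha).1 hσ).1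

/-- On G_K = ker r the cocycle is a homomorphism onto A with kernel G_L, so it identifies Gal(L/K)
with A. -/
theorem galoisModuleIso_of_cocycle
    (hrσ : ∀ σ (x : K), (r σ x : Ω) = σ x) (hrker : r.ker = K.fixingSubgroup)
    (ha : ∀ σ τ, a (σ * τ) = a σ + e (r σ) • a τ)
    (hsurj : ∀ x : A, ∃ σ, r σ = 1 ∧ a σ = x) (L : IntermediateField K Ω) [IsGalois ℚ L]
    (hL : (L.restrictScalars ℚ).fixingSubgroup = (cocycleHom r e a ha).ker) :
    GaloisModuleIso e L A := by
  obtain ⟨R, hRsurj, hR⟩ := exists_relative_restriction L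
  obtain ⟨rL, hrLsurj, hrL, -⟩ := exists_restriction L
  have hone : ∀ n : K.fixingSubgroup, r n = 1 := fun n => by
    rw [← MonoidHom.mem_ker, hrker]; exact n.2
  let θ : K.fixingSubgroup →* Multiplicative A :=
    MonoidHom.mk' (fun n => Multiplicative.ofAdd (a n)) fun n n' => by
      change Multiplicative.ofAdd (a (n * n')) = Multiplicative.ofAdd (a n + a n')
      rw [ha, hone, map_one, one_smul]
  have hθsurj : Function.Surjective θ := fun x => by
    obtain ⟨σ, hσ, hx⟩ := hsurj x.toAdd
    refine ⟨⟨σ, ?_⟩, congrArg Multiplicative.ofAdd hx⟩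
    rw [← hrker, MonoidHom.mem_ker, hσ]
  have hker : R.ker = θ.ker := by
    ext n
    have h1 : n ∈ θ.ker ↔ (n : Gal(Ω/ℚ)) ∈ (cocycleHom r e a ha).ker := by
      rw [mem_ker_cocycleHom, MonoidHom.mem_ker]
      exact ⟨fun h => ⟨hone n, h⟩, fun h => h.2⟩
    rw [h1, ← hL, MonoidHom.mem_ker, IntermediateField.mem_fixingSubgroup_iff]
    constructor
    · intro h x hx
      rw [← hR n ⟨x, hx⟩, h]
      rfl
    · intro h
      ext x
      rw [hR]
      exact h x x.2
  obtain ⟨ι, hι⟩ := MulEquiv.exists_of_surjective_of_ker_eq hRsurj hθsurj hker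
  refine ⟨ι, fun τ κ s s' hτκ hs => ?_⟩
  obtain ⟨σ, rfl⟩ := hrLsurj τ
  obtain ⟨n, rfl⟩ := hRsurj s
  have hκ : r σ = κ := by
    ext x
    rw [hrσ]
    have := congrArg (algebraMap L Ω) (hτκ x)
    exact (hrL σ _).symm.trans this
  have hn' : σ * n * σ⁻¹ ∈ K.fixingSubgroup := by
    refine hrker.le (MonoidHom.mem_ker.2 ?_)
    rw [map_mul, map_mul, hone, mul_one, ← map_mul, mul_inv_cancel, map_one]
  have hs' : R ⟨_, hn'⟩ = s' := by
    ext x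
    rw [hR]
    have h1 := congrArg (algebraMap L Ω) (AlgEquiv.congr_fun hs x)
    refine Eq.trans ?_ h1.symm
    change σ (n.1 (σ⁻¹ x)) = ((rL σ) ((R n) ((rL σ)⁻¹ x)) : Ω)
    rw [hrL, hR, ← map_inv, hrL]
  rw [← hs', hι, hι, ← hκ]
  change a (σ * n * σ⁻¹) = e (r σ) • a n
  -- Equivariance comes from expanding a(σn) both directly and as a((σnσ⁻¹)σ).
  have h1 := ha (σ * n * σ⁻¹) σ
  rw [inv_mul_cancel_right, ha σ n, map_mul r, map_mul r, hone, mul_one, ← map_mul r,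
    mul_inv_cancel, map_one, map_one, one_smul, add_comm] at h1
  exact (add_right_cancel h1).symm

theorem semidirect_of_cocycle
    (hrσ : ∀ σ (x : K), (r σ x : Ω) = σ x) (hr : Function.Surjective r)
    (ha : ∀ σ τ, a (σ * τ) = a σ + e (r σ) • a τ)
    (hsurj : ∀ x : A, ∃ σ, r σ = 1 ∧ a σ = x) (L : IntermediateField K Ω) [IsGalois ℚ L]
    (hL : (L.restrictScalars ℚ).fixingSubgroup = (cocycleHom r e a ha).ker) :
    ∃ φ : Gal(L/ℚ) ≃* Multiplicative A ⋊[actionHom e A] Gal(K/ℚ),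
      ∀ τ : Gal(L/ℚ), RestrictsTo L τ (φ τ).right := by
  obtain ⟨rL, hrLsurj, hrL, hrLker⟩ := exists_restriction L
  have hsurj' : Function.Surjective (cocycleHom r e a ha) := by
    rintro ⟨x, κ⟩
    obtain ⟨σ, rfl⟩ := hr κ
    -- Multiplying by an element of G_K corrects the cocycle value without changing the restriction
    -- to K.
    obtain ⟨n, hn, hx⟩ := hsurj (x.toAdd - a σ)
    refine ⟨n * σ, ?_⟩
    ext1
    · change Multiplicative.ofAdd (a (n * σ)) = x
      rw [ha, hn, map_one, one_smul, hx, sub_add_cancel]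
      rfl
    · change r (n * σ) = r σ
      rw [map_mul, hn, one_mul]
  obtain ⟨φ, hφ⟩ := MulEquiv.exists_of_surjective_of_ker_eq hrLsurj hsurj' (hrLker.trans hL)
  refine ⟨φ, fun τ x => ?_⟩
  obtain ⟨σ, rfl⟩ := hrLsurj τ
  rw [hφ]
  apply Subtype.ext
  rw [hrL]
  exact (hrσ σ x).symm

/-- If E existed, G_E and G_K would generate the whole group, so every element of Gal(K/ℚ) would be
the restriction of some ε ∈ G_E. For n ∈ G_K the commutator of ε and n lies in G_E ∩ G_K = G_L, so ε
acts trivially on a(n), and the action on A would be trivial. -/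
theorem not_isDefinableOverRat_of_cocycle
    (hr : Function.Surjective r) (hrker : r.ker = K.fixingSubgroup)
    (hK : IsOpen (K.fixingSubgroup : Set Gal(Ω/ℚ)))
    (ha : ∀ σ τ, a (σ * τ) = a σ + e (r σ) • a τ)
    (hsurj : ∀ x : A, ∃ σ, r σ = 1 ∧ a σ = x) (L : IntermediateField K Ω)
    (hL : (L.restrictScalars ℚ).fixingSubgroup = (cocycleHom r e a ha).ker)
    {κ : Gal(K/ℚ)} {x : A} (hx : e κ • x ≠ x) : ¬ IsDefinableOverRat L := by
  rintro ⟨E, hE, hEK, hEL⟩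
  have hEnormal : E.fixingSubgroup.Normal :=
    (InfiniteGalois.normal_iff_isGalois E).2 (isGalois_rat_congr _ _ hE)
  -- The join contains the open group G_K, so it is closed and is recovered from its fixed field,
  -- which lies in E ∩ K = ℚ.
  have htop : E.fixingSubgroup ⊔ K.fixingSubgroup = ⊤ := by
    have hopen : IsOpen ((E.fixingSubgroup ⊔ K.fixingSubgroup : Subgroup Gal(Ω/ℚ)) :
        Set Gal(Ω/ℚ)) := Subgroup.isOpen_mono le_sup_right hK
    have h1 := InfiniteGalois.fixingSubgroup_fixedField (K := Ω) (k := ℚ)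
      ⟨E.fixingSubgroup ⊔ K.fixingSubgroup, Subgroup.isClosed_of_isOpen _ hopen⟩
    have h2 : IntermediateField.fixedField (E.fixingSubgroup ⊔ K.fixingSubgroup) = ⊥ := by
      rw [eq_bot_iff, ← hEK]
      refine le_inf ?_ ?_
      · nth_rewrite 2 [← InfiniteGalois.fixedField_fixingSubgroup E]
        rw [IntermediateField.le_iff_le]
        exact le_sup_left.trans ((IntermediateField.le_iff_le _ _).1 le_rfl)
      · nth_rewrite 2 [← InfiniteGalois.fixedField_fixingSubgroup K]
        rw [IntermediateField.le_iff_le]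
        exact le_sup_right.trans ((IntermediateField.le_iff_le _ _).1 le_rfl)
    change (IntermediateField.fixedField (E.fixingSubgroup ⊔ K.fixingSubgroup)).fixingSubgroup =
      E.fixingSubgroup ⊔ K.fixingSubgroup at h1
    rw [← h1, h2, IntermediateField.fixingSubgroup_bot]
  obtain ⟨σ, rfl⟩ := hr κ
  obtain ⟨n, hn, rfl⟩ := hsurj x
  have hσ : σ ∈ E.fixingSubgroup ⊔ K.fixingSubgroup := htop ▸ Subgroup.mem_top σ
  obtain ⟨ε, hε, κ', hκ', rfl⟩ := Subgroup.mem_sup_of_normal_left.1 hσ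
  have hκ1 : r κ' = 1 := by rw [← MonoidHom.mem_ker, hrker]; exact hκ'
  rw [map_mul, hκ1, mul_one] at hx
  have hE' : ε * n * ε⁻¹ * n⁻¹ ∈ E.fixingSubgroup := by
    rw [mul_assoc, mul_assoc ε]
    exact mul_mem hε (by
      rw [← mul_assoc]
      exact hEnormal.conj_mem _ (inv_mem hε) n)
  have hK' : ε * n * ε⁻¹ * n⁻¹ ∈ K.fixingSubgroup := by
    rw [← hrker, MonoidHom.mem_ker, map_mul, map_mul, map_mul, map_inv, map_inv, hn]
    group
  have hLmem : ε * n * ε⁻¹ * n⁻¹ ∈ (cocycleHom r e a ha).ker := by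
    rw [← hL, ← hEL, IntermediateField.fixingSubgroup_sup]
    exact ⟨hE', hK'⟩
  have h0 := ((mem_ker_cocycleHom ha).1 hLmem).2
  have h1 := ha (ε * n * ε⁻¹ * n⁻¹) (n * ε)
  rw [show ε * n * ε⁻¹ * n⁻¹ * (n * ε) = ε * n by group, h0,
    ((mem_ker_cocycleHom ha).1 hLmem).1, map_one, one_smul, zero_add, ha, ha, hn, map_one,
    one_smul, add_comm] at h1
  exact hx (add_right_cancel h1)

end Cocycle

omit [IsGalois ℚ Ω] in
theorem isAbelianGalois_of_galoisModuleIso {Γ A : Type*} [Group Γ] [AddCommGroup A]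
    [DistribMulAction Γ A] {e : Gal(K/ℚ) →* Γ} {L : IntermediateField K Ω} [IsGalois ℚ L]
    [FiniteDimensional ℚ L] (h : GaloisModuleIso e L A) :
    IsAbelianGalois K L ∧ Module.finrank K L = Nat.card A := by
  have : IsGalois K L := IsGalois.tower_top_of_isGalois ℚ K L
  have : FiniteDimensional K L := Module.Finite.of_restrictScalars_finite ℚ K L
  obtain ⟨ι, -⟩ := h
  constructor
  · exact { is_comm := ⟨fun s t => ι.injective (by rw [map_mul, map_mul, mul_comm])⟩ }
  · rw [← IsGalois.card_aut_eq_finrank, Nat.card_congr ι.toEquiv]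
    rfl

theorem sup_eq_of_fixingSubgroup {L L₁ L₂ : IntermediateField K Ω}
    (h : (L₁.restrictScalars ℚ).fixingSubgroup ⊓ (L₂.restrictScalars ℚ).fixingSubgroup =
      (L.restrictScalars ℚ).fixingSubgroup) : L₁ ⊔ L₂ = L := by
  have h1 : L₁.restrictScalars ℚ ⊔ L₂.restrictScalars ℚ = L.restrictScalars ℚ := by
    rw [← InfiniteGalois.fixedField_fixingSubgroup (L₁.restrictScalars ℚ ⊔ L₂.restrictScalars ℚ),
      IntermediateField.fixingSubgroup_sup, h, InfiniteGalois.fixedField_fixingSubgroup]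
  rw [← IntermediateField.restrictScalars_inj ℚ, ← h1, IntermediateField.restrictScalars_sup]

end Galois

/-! ### Inertia groups and ramification -/

section Inertia

open scoped Pointwise

variable {K L Ω : Type*} [Field K] [Field L] [Field Ω] [Algebra K L] [Algebra L Ω] [Algebra K Ω]
  [IsScalarTower K L Ω]

theorem coe_smul_ringOfIntegers (σ : Gal(L/K)) (x : 𝓞 L) : ((σ • x : 𝓞 L) : L) = σ x := rfl

instance smulCommClass_ringOfIntegers : SMulCommClass Gal(L/K) (𝓞 K) (𝓞 L) where
  smul_comm σ a b := by
    apply NumberField.RingOfIntegers.ext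
    rw [Algebra.smul_def, Algebra.smul_def]
    change σ (algebraMap K L a * b) = algebraMap K L a * σ b
    rw [map_mul, σ.commutes]

theorem isInvariant_ringOfIntegers [IsGalois K L] :
    Algebra.IsInvariant (𝓞 K) (𝓞 L) Gal(L/K) where
  isInvariant b hb := by
    have h1 : (b : L) ∈ Set.range (algebraMap K L) := by
      rw [InfiniteGalois.mem_range_algebraMap_iff_fixed]
      intro f
      rw [← coe_smul_ringOfIntegers, hb]
    obtain ⟨a, ha⟩ := h1
    have ha' : IsIntegral ℤ a := by
      rw [← isIntegral_algebraMap_iff (algebraMap K L).injective (R := ℤ), ha]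
      exact b.isIntegral_coe
    exact ⟨⟨a, ha'⟩, NumberField.RingOfIntegers.ext ha⟩

theorem continuousSMul_ringOfIntegers [Algebra.IsIntegral K L] [TopologicalSpace (𝓞 L)]
    [DiscreteTopology (𝓞 L)] : ContinuousSMul Gal(L/K) (𝓞 L) := by
  rw [continuousSMul_iff_stabilizer_isOpen]
  intro x
  convert stabilizer_isOpen_of_isIntegral (K := K) (x : L) using 2
  ext σ
  rw [MulAction.mem_stabilizer_iff, MulAction.mem_stabilizer_iff, NumberField.RingOfIntegers.ext_iff]
  rfl

/-- Elements of the inertia group of a prime lift to elements of inertia in a Galois extension,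
possibly of infinite degree. -/
theorem exists_inertia_lift [IsGalois K L] [IsGalois K Ω] (P : Ideal (𝓞 L)) [P.IsPrime]
    {σ : Gal(L/K)} (hσ : σ ∈ P.inertia Gal(L/K)) :
    ∃ 𝔓 : Ideal (𝓞 Ω), 𝔓.IsPrime ∧ 𝔓.LiesOver P ∧ ∃ s ∈ 𝔓.inertia Gal(Ω/K),
      ∀ x : L, s (algebraMap L Ω x) = algebraMap L Ω (σ x) := by
  have : IsGalois L Ω := IsGalois.tower_top_of_isGalois K L Ω
  let : TopologicalSpace (𝓞 Ω) := ⊥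
  have : DiscreteTopology (𝓞 Ω) := ⟨rfl⟩
  have := continuousSMul_ringOfIntegers (K := L) (L := Ω)
  have := isInvariant_ringOfIntegers (K := L) (L := Ω)
  have : Algebra.IsIntegral (𝓞 L) (𝓞 Ω) :=
    Algebra.IsInvariant.isIntegral_of_profinite (G := Gal(Ω/L))
  have hinj : Function.Injective (algebraMap (𝓞 L) (𝓞 Ω)) := fun x y h => by
    apply NumberField.RingOfIntegers.ext
    exact (algebraMap L Ω).injective (congrArg (algebraMap (𝓞 Ω) Ω) h)
  obtain ⟨𝔓, -, h𝔓, hP⟩ := Ideal.exists_ideal_over_prime_of_isIntegral P (⊥ : Ideal (𝓞 Ω)) (by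
    rw [Ideal.comap_bot_of_injective _ hinj]
    exact bot_le)
  have hlies : 𝔓.LiesOver P := ⟨hP.symm⟩
  obtain ⟨s, hs⟩ := AlgEquiv.restrictNormalHom_surjective (F := K) (K₁ := L) Ω σ
  have hsσ : ∀ x : L, s (algebraMap L Ω x) = algebraMap L Ω (σ x) := fun x => by
    rw [← hs]
    exact (AlgEquiv.restrictNormal_commutes s L x).symm
  have hsσ' : ∀ x : 𝓞 L, s • algebraMap (𝓞 L) (𝓞 Ω) x = algebraMap (𝓞 L) (𝓞 Ω) (σ • x) := by
    intro x
    apply NumberField.RingOfIntegers.ext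
    exact hsσ x
  have hσP : σ • P = P := P.inertia_le_stabilizer hσ
  have hmem : ∀ x : 𝓞 L, σ⁻¹ • x ∈ P ↔ x ∈ P := fun x => by
    nth_rewrite 2 [← hσP]
    rw [Ideal.mem_pointwise_smul_iff_inv_smul_mem]
  have hsinv : ∀ x : 𝓞 L, s⁻¹ • algebraMap (𝓞 L) (𝓞 Ω) x = algebraMap (𝓞 L) (𝓞 Ω) (σ⁻¹ • x) := by
    intro x
    rw [inv_smul_eq_iff, hsσ', smul_inv_smul]
  have hunder : (s • 𝔓).under (𝓞 L) = 𝔓.under (𝓞 L) := by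
    ext x
    have h1 : ∀ y, algebraMap (𝓞 L) (𝓞 Ω) y ∈ 𝔓 ↔ y ∈ P := fun y => by
      rw [hlies.over]; rfl
    rw [Ideal.under, Ideal.under, Ideal.mem_comap, Ideal.mem_comap,
      Ideal.mem_pointwise_smul_iff_inv_smul_mem, hsinv, h1, h1, hmem]
  -- The primes s𝔓 and 𝔓 both lie over P, so some g ∈ Gal(Ω/L) moves one to the other; then gs lies
  -- in the decomposition group of 𝔓 and still restricts to σ.
  obtain ⟨g, hg⟩ := Algebra.IsInvariant.exists_smul_of_under_eq_of_profinite (A := 𝓞 L)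
    (G := Gal(Ω/L)) (s • 𝔓) 𝔓 hunder
  let res : Gal(Ω/L) → Gal(Ω/K) := fun h => h.restrictScalars K
  have hres : ∀ (h : Gal(Ω/L)) (x : 𝓞 Ω), res h • x = h • x := fun h x => rfl
  have hgs : res g * s ∈ MulAction.stabilizer Gal(Ω/K) 𝔓 := by
    rw [MulAction.mem_stabilizer_iff, mul_smul]
    refine Eq.trans ?_ hg.symm
    ext x
    rw [Ideal.mem_pointwise_smul_iff_inv_smul_mem, Ideal.mem_pointwise_smul_iff_inv_smul_mem,
      Ideal.mem_pointwise_smul_iff_inv_smul_mem, Ideal.mem_pointwise_smul_iff_inv_smul_mem]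
    rfl
  let f₀ := Ideal.Quotient.stabilizerHom 𝔓 (𝔓.under (𝓞 K)) Gal(Ω/K) ⟨res g * s, hgs⟩
  have hgsL : ∀ x : 𝓞 L, (res g * s) • algebraMap (𝓞 L) (𝓞 Ω) x =
      algebraMap (𝓞 L) (𝓞 Ω) (σ • x) := by
    intro x
    rw [mul_smul, hsσ', hres]
    apply NumberField.RingOfIntegers.ext
    exact g.commutes _
  -- The residual action of gs is linear over 𝓞 L ⧸ P precisely because σ is inertial. It is
  -- therefore induced by some h ∈ Gal(Ω/L), and h⁻¹gs is the desired lift.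
  let f : (𝓞 Ω ⧸ 𝔓) ≃ₐ[𝓞 L ⧸ P] (𝓞 Ω ⧸ 𝔓) := AlgEquiv.ofRingEquiv (f := f₀.toRingEquiv) (by
    intro y
    obtain ⟨x, rfl⟩ := Ideal.Quotient.mk_surjective y
    change f₀ (Ideal.Quotient.mk 𝔓 (algebraMap (𝓞 L) (𝓞 Ω) x)) =
      Ideal.Quotient.mk 𝔓 (algebraMap (𝓞 L) (𝓞 Ω) x)
    refine (Ideal.Quotient.stabilizerHom_apply _ _ _ _ _).trans ?_
    change Ideal.Quotient.mk 𝔓 ((res g * s) • algebraMap (𝓞 L) (𝓞 Ω) x) = _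
    rw [hgsL, Ideal.Quotient.eq, ← map_sub]
    have : σ • x - x ∈ P := hσ x
    rw [hlies.over] at this
    exact this)
  obtain ⟨h, hh⟩ := Ideal.Quotient.stabilizerHom_surjective_of_profinite (G := Gal(Ω/L)) P 𝔓 f
  refine ⟨𝔓, h𝔓, hlies, res (h⁻¹ : MulAction.stabilizer Gal(Ω/L) 𝔓).1 * (res g * s), ?_, ?_⟩
  · intro x
    have h1 : Ideal.Quotient.mk 𝔓 (h.1 • x) = Ideal.Quotient.mk 𝔓 ((res g * s) • x) :=
      AlgEquiv.congr_fun hh (Ideal.Quotient.mk 𝔓 x)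
    rw [Ideal.Quotient.eq] at h1
    have h2 : h.1⁻¹ • (h.1 • x - (res g * s) • x) ∈ 𝔓 := by
      have h3 : (h.1⁻¹ : Gal(Ω/L)) • 𝔓 = 𝔓 := inv_mem h.2
      exact h3.le (Ideal.smul_mem_pointwise_smul _ _ _ h1)
    rw [smul_sub, inv_smul_smul] at h2
    rw [mul_smul]
    change h.1⁻¹ • ((res g * s) • x) - x ∈ 𝔓
    rw [← neg_sub]
    exact neg_mem h2
  · intro x
    change h.1⁻¹ (g (s (algebraMap L Ω x))) = _
    rw [hsσ, g.commutes]
    exact (h.1⁻¹ : Gal(Ω/L)).commutes _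

/-- The inertia group has order the ramification index, residue fields at nonzero primes being
finite and hence perfect. -/
theorem isUnramifiedAt_of_inertia_eq_bot [NumberField K] [NumberField L] [IsGalois K L]
    (P : Ideal (𝓞 L)) [P.IsPrime] (hP : P.inertia Gal(L/K) = ⊥) (hP0 : P ≠ ⊥) :
    Algebra.IsUnramifiedAt (𝓞 K) P := by
  have h0 : P.under (𝓞 K) ≠ ⊥ := fun h => hP0 (Ideal.eq_bot_of_comap_eq_bot h)
  have : (P.under (𝓞 K)).IsMaximal := Ideal.IsPrime.isMaximal inferInstance h0
  have : Finite (𝓞 K ⧸ P.under (𝓞 K)) := Ring.HasFiniteQuotients.finiteQuotient h0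
  have : Finite (P.under (𝓞 K)).ResidueField := by
    have := Ideal.bijective_algebraMap_quotient_residueField (P.under (𝓞 K))
    exact Finite.of_surjective _ this.2
  rw [← Ideal.ramificationIdx_eq_one_iff,
    ← Ideal.ramificationIdxIn_eq_ramificationIdx (P.under (𝓞 K)) P Gal(L/K),
    ← Ideal.card_inertia_eq_ramificationIdxIn (G := Gal(L/K)) (P.under (𝓞 K)) P, hP]
  simp

end Inertia

theorem isUnramifiedExtAt_of_inertia_le {K : IntermediateField ℚ (AlgebraicClosure ℚ)}
    {L : IntermediateField K (AlgebraicClosure ℚ)} [NumberField K] [NumberField L]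
    [IsGalois ℚ L] {ℓ : ℕ} (hℓ : ℓ ≠ 0)
    (h : ∀ 𝔓 : Ideal (𝓞 (AlgebraicClosure ℚ)), 𝔓.IsPrime →
      (ℓ : 𝓞 (AlgebraicClosure ℚ)) ∈ 𝔓 →
      𝔓.inertia Gal(AlgebraicClosure ℚ/ℚ) ≤ (L.restrictScalars ℚ).fixingSubgroup) :
    IsUnramifiedExtAt K L ℓ := by
  intro P _ hP
  have : IsGalois K L := IsGalois.tower_top_of_isGalois ℚ K L
  have : IsGalois K (AlgebraicClosure ℚ) := IsGalois.tower_top_of_isGalois ℚ K _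
  refine isUnramifiedAt_of_inertia_eq_bot P ?_ ?_
  · rw [eq_bot_iff]
    intro σ hσ
    obtain ⟨𝔓, h𝔓, hlies, s, hs, hsσ⟩ := exists_inertia_lift (Ω := AlgebraicClosure ℚ) P hσ
    have hmem : (ℓ : 𝓞 (AlgebraicClosure ℚ)) ∈ 𝔓 := by
      rw [hlies.over] at hP
      have : algebraMap (𝓞 L) (𝓞 (AlgebraicClosure ℚ)) (ℓ : 𝓞 L) ∈ 𝔓 := hP
      rwa [map_natCast] at this
    have hs' : s.restrictScalars ℚ ∈ 𝔓.inertia Gal(AlgebraicClosure ℚ/ℚ) := fun x => hs x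
    have h1 := (IntermediateField.mem_fixingSubgroup_iff _ _).1 (h 𝔓 h𝔓 hmem hs')
    rw [Subgroup.mem_bot]
    ext x
    exact (hsσ x).symm.trans (h1 x x.2)
  -- The zero ideal is excluded because ℓ ≠ 0 lies in P.
  · rintro rfl
    rw [Ideal.mem_bot, Nat.cast_eq_zero] at hP
    exact hℓ hP

/-! ### From the representation to the cocycle -/

section Assembly

variable {k T : Type*} [Field k] [CommRing T] [Algebra k T]

theorem map_mem_GLTwoDet_iff {F : Type*} [Field F] [Algebra k F] {D : Subgroup kˣ}
    {g : GL (Fin 2) k} :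
    Matrix.GeneralLinearGroup.map (algebraMap k F) g ∈ GLTwoDet D F ↔ g ∈ GLTwoDet D k := by
  rw [mem_GLTwoDet_self, GLTwoDet, Subgroup.mem_comap]
  have h1 : Matrix.GeneralLinearGroup.det (Matrix.GeneralLinearGroup.map (algebraMap k F) g) =
      Units.map (algebraMap k F).toMonoidHom (Matrix.GeneralLinearGroup.det g) := by
    ext
    exact ((algebraMap k F).map_det _).symm
  rw [h1]
  exact Subgroup.mem_map_iff_mem (Units.map_injective (algebraMap k F).injective)

/-- Fullness is assumed over the residue field F of T; this carries it over to k, where matrices can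
be lifted back to T as constants. -/
theorem hasFullReduction_of_range_eq {F : Type*} [Field F] [Algebra k F] {D : Subgroup kˣ}
    {π : T →ₐ[k] k} {q : T →+* F} (hq : ∀ x, algebraMap k F (π x) = q x)
    {G : Subgroup (GL (Fin 2) T)}
    (hG : G.map (Matrix.GeneralLinearGroup.map q) = GLTwoDet D F) (hle : G ≤ GLTwoDet D T) :
    HasFullReduction π D G := by
  have hcomp : ∀ g : GL (Fin 2) T, Matrix.GeneralLinearGroup.map (algebraMap k F)
      (Matrix.GeneralLinearGroup.map (π : T →+* k) g) = Matrix.GeneralLinearGroup.map q g := by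
    intro g
    ext i j
    exact hq _
  have hinj : Function.Injective
      (Matrix.GeneralLinearGroup.map (n := Fin 2) (algebraMap k F)) := by
    intro g g' h
    ext i j
    exact (algebraMap k F).injective (congrArg (fun x : GL (Fin 2) F => x i j) h)
  refine ⟨?_, hle⟩
  ext γ
  rw [← map_mem_GLTwoDet_iff (F := F), ← hG]
  constructor
  · rintro ⟨g, hg, rfl⟩
    exact ⟨g, hg, (hcomp g).symm⟩
  · rintro ⟨g, hg, h⟩
    refine ⟨g, hg, hinj ?_⟩
    rw [hcomp, h]

namespace HasFullReduction

variable {π : T →ₐ[k] k} {D : Subgroup kˣ} {H : Type*} [Group H] {ρ : H →* GL (Fin 2) T}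

/-- If the image of `ρ` contains `GL_2^D(k)`, then `ρ` is the product of a cocycle with values in
the kernel module and of its reduction. -/
theorem exists_cocycle (h : HasFullReduction π D ρ.range)
    (hπ : ∀ x y, π x = 0 → π y = 0 → x * y = 0)
    (hΓ : ∀ γ ∈ GLTwoDet D k, Matrix.GeneralLinearGroup.map (algebraMap k T) γ ∈ ρ.range)
    (e₀ : H →* GLTwoDet D k)
    (he₀ : ∀ σ, (e₀ σ : GL (Fin 2) k) = Matrix.GeneralLinearGroup.map (π : T →+* k) (ρ σ)) :
    ∃ a : H → (h.kernelModule hπ).Elem, (∀ σ τ, a (σ * τ) = a σ + e₀ σ • a τ) ∧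
      ∀ σ, (ρ σ : Matrix (Fin 2) (Fin 2) T) =
        (1 + (a σ).1) * (algebraMap k T).mapMatrix ((e₀ σ : GL (Fin 2) k) :
          Matrix (Fin 2) (Fin 2) k) := by
  let ι : GLTwoDet D k →* GL (Fin 2) T :=
    (Matrix.GeneralLinearGroup.map (algebraMap k T)).comp (GLTwoDet D k).subtype
  let c : H → GL (Fin 2) T := fun σ => ρ σ * (ι (e₀ σ))⁻¹
  have hcπ : ∀ σ, Matrix.GeneralLinearGroup.map (π : T →+* k) (c σ) = 1 := by
    intro σ
    have : Matrix.GeneralLinearGroup.map (π : T →+* k) (ι (e₀ σ)) = e₀ σ := by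
      ext i j
      exact AlgHom.commutes π _
    rw [map_mul, map_inv, this, ← he₀, mul_inv_cancel]
  have hmem : ∀ σ, (c σ : Matrix (Fin 2) (Fin 2) T) - 1 ∈ (h.kernelModule hπ).toAddSubgroup := by
    intro σ
    rw [mem_kernelModule]
    constructor
    · intro i j
      have := congrArg (fun x : GL (Fin 2) k => x i j) (hcπ σ)
      have h1 : π ((c σ : Matrix (Fin 2) (Fin 2) T) i j) = (1 : Matrix (Fin 2) (Fin 2) k) i j :=
        this
      rw [Matrix.sub_apply, map_sub, h1, Matrix.one_apply, Matrix.one_apply]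
      split_ifs <;> simp
    · rw [add_sub_cancel, coe_mem_matricesOf]
      exact mul_mem ⟨σ, rfl⟩ (inv_mem (hΓ _ (e₀ σ).2))
  let a : H → (h.kernelModule hπ).Elem := fun σ =>
    (⟨_, hmem σ⟩ : (h.kernelModule hπ).toAddSubgroup)
  have haval : ∀ σ, (c σ : Matrix (Fin 2) (Fin 2) T) = 1 + (a σ).1 := fun σ =>
    (add_sub_cancel _ _).symm
  -- The multiplicative cocycle rule for 1 + a becomes additive because the product term vanishes.
  have key : ∀ A B C P P' : Matrix (Fin 2) (Fin 2) T, P * P' = 1 → A * (P * B * P') = 0 →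
      1 + C = (1 + A) * (P * (1 + B) * P') → C = A + P * B * P' := by
    intro A B C P P' h1 h2 h3
    rw [mul_add P, mul_one, add_mul P, h1, mul_add, mul_one, add_mul, h2, one_mul, add_zero,
      add_assoc] at h3
    exact add_left_cancel h3
  refine ⟨a, fun σ τ => Subtype.ext ?_, fun σ => ?_⟩
  · have hc : c (σ * τ) = c σ * (ι (e₀ σ) * c τ * (ι (e₀ σ))⁻¹) := by
      simp only [c, map_mul]
      group
    have h1 : (c (σ * τ) : Matrix (Fin 2) (Fin 2) T) = (c σ : Matrix (Fin 2) (Fin 2) T) *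
        ((ι (e₀ σ) : Matrix (Fin 2) (Fin 2) T) * (c τ : Matrix (Fin 2) (Fin 2) T) *
          ((ι (e₀ σ))⁻¹ : GL (Fin 2) T)) := congrArg Units.val hc
    rw [haval, haval, haval] at h1
    exact key _ _ _ _ _ (Units.mul_inv (ι (e₀ σ))) (Matrix.mul_eq_zero_of_map_eq_zero hπ (a σ).2.1
      (Matrix.map_eq_zero_mul_mul (a τ).2.1 _ _)) h1
  · rw [← haval]
    change _ = ((c σ * ι (e₀ σ) : GL (Fin 2) T) : Matrix (Fin 2) (Fin 2) T)
    rw [inv_mul_cancel_right]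

end HasFullReduction

theorem card_traceZero [CharP k 2] [Finite k] (D : Subgroup kˣ) :
    Nat.card (TraceZero D) = Nat.card k ^ 3 := by
  let F : TraceZero D → k × k × k := fun A => (A.1 0 0, A.1 0 1, A.1 1 0)
  have hF : Function.Bijective F := by
    constructor
    · intro A B h
      obtain ⟨h1, h2⟩ := Prod.ext_iff.1 h
      obtain ⟨h2, h3⟩ := Prod.ext_iff.1 h2
      refine Subtype.ext ?_
      rw [ConjSubmodule.eq_fin_two_of_trace_eq_zero (k := k) A.2.1,
        ConjSubmodule.eq_fin_two_of_trace_eq_zero (k := k) B.2.1]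
      exact Matrix.fin_two_congr h1 h2 h3 h1
    · rintro ⟨x, b, c⟩
      exact ⟨(⟨!![x, b; c, x], by
        rw [Matrix.trace_fin_two]
        exact CharTwo.add_self_eq_zero _, fun _ _ => Submodule.mem_top⟩ :
          (ConjSubmodule.traceZero D (⊤ : Ideal k)).toAddSubgroup), rfl⟩
  rw [Nat.card_eq_of_bijective F hF, Nat.card_prod, Nat.card_prod]
  ring

theorem card_scalarCTwo [CharP k 2] (D : Subgroup kˣ) : Nat.card (ScalarCTwo D) = 2 := by
  change Nat.card (AddSubgroup.zmultiples (1 : Matrix (Fin 2) (Fin 2) k)) = 2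
  rw [Nat.card_zmultiples]
  refine addOrderOf_eq_prime ?_ one_ne_zero
  rw [nsmul_eq_mul, mul_one]
  exact CharP.cast_eq_zero (Matrix (Fin 2) (Fin 2) k) 2

/-- The Weyl element exchanges the two off-diagonal matrix units. This nontrivial action is what
obstructs a definition of L₁ over ℚ. -/
theorem exists_smul_ne_traceZero [CharP k 2] (D : Subgroup kˣ) {n : ℕ} (hn : n ≠ 0) :
    ∃ (g : GLTwoDet D k) (x : Fin n → TraceZero D), g • x ≠ x := by
  let y : TraceZero D := (⟨!![0, 1; 0, 0], by simp [Matrix.trace_fin_two],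
    fun _ _ => Submodule.mem_top⟩ : (ConjSubmodule.traceZero D (⊤ : Ideal k)).toAddSubgroup)
  refine ⟨GLTwoDet.ofDetOne D !![0, 1; 1, 0] (by simp [Matrix.det_fin_two, CharTwo.neg_eq]),
    fun _ => y, fun h => ?_⟩
  have h1 := congrArg Subtype.val (congrFun h ⟨0, Nat.pos_of_ne_zero hn⟩)
  have h2 := congrFun (congrFun h1 0) 1
  change (!![0, 1; 1, 0] * !![0, 1; 0, 0] * Matrix.adjugate !![0, 1; 1, 0] :
    Matrix (Fin 2) (Fin 2) k) 0 1 = (1 : k) at h2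
  simp [Matrix.adjugate_fin_two_of] at h2

end Assembly

/-! ### The main theorem -/

theorem isOpen_ker_of_continuous {H T : Type*} [Group H] [TopologicalSpace H] [CommRing T]
    [TopologicalSpace T] [DiscreteTopology T] {ρ : H →* GL (Fin 2) T} (hρ : Continuous ρ) :
    IsOpen (ρ.ker : Set H) := by
  have h1 : Continuous fun σ => (ρ σ : Matrix (Fin 2) (Fin 2) T) := Units.continuous_val.comp hρ
  have h2 : (ρ.ker : Set H) = ⋂ i : Fin 2, ⋂ j : Fin 2,
      (fun σ => (ρ σ : Matrix (Fin 2) (Fin 2) T) i j) ⁻¹' {(1 : Matrix (Fin 2) (Fin 2) T) i j} := by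
    ext σ
    simp only [SetLike.mem_coe, MonoidHom.mem_ker, Set.mem_iInter, Set.mem_preimage,
      Set.mem_singleton_iff]
    constructor
    · intro h i j
      rw [h]
      rfl
    · intro h
      ext i j
      exact h i j
  rw [h2]
  refine isOpen_iInter_of_finite fun i => isOpen_iInter_of_finite fun j => ?_
  exact (isOpen_discrete _).preimage (h1.matrix_elem i j)

/-- The retraction of a local algebra with residue field `k` onto `k`. -/
theorem exists_retraction {k T : Type*} [Field k] [CommRing T] [IsLocalRing T] [Algebra k T]
    (hres : Function.Bijective (algebraMap k (IsLocalRing.ResidueField T))) :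
    ∃ π : T →ₐ[k] k, (∀ x, algebraMap k (IsLocalRing.ResidueField T) (π x) =
      IsLocalRing.residue T x) ∧ RingHom.ker π = IsLocalRing.maximalIdeal T := by
  let E : k ≃ₐ[k] IsLocalRing.ResidueField T :=
    AlgEquiv.ofBijective (Algebra.ofId k (IsLocalRing.ResidueField T)) hres
  let π : T →ₐ[k] k :=
    E.symm.toAlgHom.comp (IsScalarTower.toAlgHom k T (IsLocalRing.ResidueField T))
  have hπ : ∀ x, algebraMap k (IsLocalRing.ResidueField T) (π x) = IsLocalRing.residue T x :=
    fun x => E.apply_symm_apply _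
  refine ⟨π, hπ, ?_⟩
  ext x
  rw [RingHom.mem_ker, ← IsLocalRing.residue_eq_zero_iff, ← hπ,
    map_eq_zero_iff _ (algebraMap k (IsLocalRing.ResidueField T)).injective]

theorem proposition5p2
    -- the finite field `k = 𝔽_q` of characteristic `2`, with `q = 2 ^ d` and `q ≠ 2`
    {k : Type*} [Field k] [Finite k] [CharP k 2] (d : ℕ) (hd : Nat.card k = 2 ^ d)
    (hk : Nat.card k ≠ 2)
    -- the finite-dimensional local `k`-algebra `T` with residue field `k` and `𝔪 ^ 2 = 0`
    {T : Type*} [CommRing T] [IsLocalRing T] [Algebra k T] [Module.Finite k T]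
    [TopologicalSpace T] [DiscreteTopology T]
    (hres : Function.Bijective (algebraMap k (IsLocalRing.ResidueField T)))
    (hsq : IsLocalRing.maximalIdeal T ^ 2 = ⊥)
    -- the representation and its reduction
    (ρ : Gal(AlgebraicClosure ℚ/ℚ) →* GL (Fin 2) T) (hρ : Continuous ρ)
    (ρbar : Gal(AlgebraicClosure ℚ/ℚ) →* GL (Fin 2) (IsLocalRing.ResidueField T))
    (hρbar : ρbar = (Matrix.GeneralLinearGroup.map (IsLocalRing.residue T)).comp ρ)
    (D : Subgroup kˣ)
    (ha : ρbar.range = GLTwoDet D (IsLocalRing.ResidueField T))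
    (hb : ρ.range ≤ GLTwoDet D T)
    (hc : Algebra.adjoin k
      (Set.range fun σ => (ρ σ : Matrix (Fin 2) (Fin 2) T).trace) = ⊤)
    -- `ρ` is unramified outside `2 N`
    (N : ℕ) (hN : 1 ≤ N)
    (hunr : ∀ ℓ : ℕ, ℓ.Prime → ¬ ℓ ∣ 2 * N → IsUnramifiedRepAt ρ ℓ)
    (m : ℕ) (hm : m = Module.finrank k (IsLocalRing.maximalIdeal T))
    (t : ℕ) (ht : t = (Set.range fun σ => (ρ σ : Matrix (Fin 2) (Fin 2) T).trace).ncard) :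
    ∃ α β : ℕ, α ≤ m ∧ β ≤ d * (m - α) ∧
      t = (2 ^ d) ^ α * ((2 ^ d - 1) * 2 ^ β + 1) ∧
      ∃ (K : IntermediateField ℚ (AlgebraicClosure ℚ))
        (L : IntermediateField K (AlgebraicClosure ℚ)),
        NumberField K ∧ NumberField L ∧ IsGalois ℚ K ∧ IsGalois ℚ L ∧
        K.fixingSubgroup = ρbar.ker ∧
        (L.restrictScalars ℚ).fixingSubgroup = ρ.ker ∧
        -- `Gal(K/ℚ) ≅ GL_2^D(k)`, the isomorphism being the one induced by `ρbar`
        ∃ e : Gal(K/ℚ) ≃* GLTwoDet D k,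
          (∀ (σ : Gal(AlgebraicClosure ℚ/ℚ)) (κ : Gal(K/ℚ)),
            (∀ x : K, σ (x : AlgebraicClosure ℚ) = (κ x : AlgebraicClosure ℚ)) →
            Matrix.GeneralLinearGroup.map (algebraMap k (IsLocalRing.ResidueField T))
              (e κ : GL (Fin 2) k) = ρbar σ) ∧
          -- the module `M ⊆ M_2^0(𝔪)`, isomorphic to `M_2^0(k) ^ α ⊕ C_2 ^ β`
          (∃ M : ConjSubmodule D T,
            M.toAddSubgroup ≤
              (ConjSubmodule.traceZero D (IsLocalRing.maximalIdeal T)).toAddSubgroup ∧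
            (∃ f : M.Elem ≃+ (Fin α → TraceZero D) × (Fin β → ScalarCTwo D),
              ∀ (g : GLTwoDet D k) (x : M.Elem), f (g • x) = g • f x) ∧
            -- `Gal(L/ℚ) ≅ M ⋊ Gal(K/ℚ)`, compatibly with the projections to `Gal(K/ℚ)`
            (∃ φ : Gal(L/ℚ) ≃* Multiplicative M.Elem ⋊[actionHom e.toMonoidHom M.Elem] Gal(K/ℚ),
              ∀ τ : Gal(L/ℚ), RestrictsTo L τ (φ τ).right) ∧
            -- the conjugation action of `Gal(K/ℚ)` on `Gal(L/K)`
            GaloisModuleIso e.toMonoidHom L M.Elem) ∧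
          IsAbelianGalois K L ∧ Module.finrank K L = 2 ^ (3 * d * α + β) ∧
          (∀ ℓ : ℕ, ℓ.Prime → ¬ ℓ ∣ 2 * N → IsUnramifiedExtAt K L ℓ) ∧
          (α ≠ 0 →
            ∃ L₁ L₂ : IntermediateField K (AlgebraicClosure ℚ),
              IsGalois ℚ L₁ ∧ IsGalois ℚ L₂ ∧ L₁ ⊔ L₂ = L ∧
              GaloisModuleIso e.toMonoidHom L₁ (Fin α → TraceZero D) ∧
              ¬ IsDefinableOverRat L₁ ∧
              GaloisModuleIso e.toMonoidHom L₂ (Fin β → ScalarCTwo D)) := by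
  have hk2 : 2 < Nat.card k := by
    have := Finite.one_lt_card (α := k)
    omega
  obtain ⟨π, hπres, hπker⟩ := exists_retraction hres
  have hπ0 : ∀ x, π x = 0 ↔ x ∈ IsLocalRing.maximalIdeal T := fun x => by
    rw [← hπker, RingHom.mem_ker]
  have hπ : ∀ x y, π x = 0 → π y = 0 → x * y = 0 := by
    intro x y hx hy
    rw [hπ0] at hx hy
    have := Ideal.mul_mem_mul hx hy
    rwa [← sq, hsq, Ideal.mem_bot] at this
  have hfull : HasFullReduction π D ρ.range := by
    refine hasFullReduction_of_range_eq hπres ?_ hb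
    rw [← ha, hρbar, MonoidHom.range_comp]
  obtain ⟨u, hu, huΓ⟩ := hfull.exists_conj_contains hk2 hπ
  have hfull' := hfull.conj u hu
  -- The conjugate ρ' has the same kernel, traces and reduction as ρ, so it may replace ρ
  -- throughout.
  let ρ' : Gal(AlgebraicClosure ℚ/ℚ) →* GL (Fin 2) T := (MulAut.conj u).toMonoidHom.comp ρ
  have hρ'range : ρ.range.map (MulAut.conj u).toMonoidHom = ρ'.range :=
    (MonoidHom.range_comp _ _).symm
  rw [hρ'range] at hfull' huΓ
  have hρ'ker : ρ'.ker = ρ.ker := by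
    ext σ
    rw [MonoidHom.mem_ker, MonoidHom.mem_ker]
    exact map_eq_one_iff _ (MulAut.conj u).injective
  -- the reduction, with values in `GL_2^D(k)`
  let e₀ : Gal(AlgebraicClosure ℚ/ℚ) →* GLTwoDet D k :=
    ((Matrix.GeneralLinearGroup.map (π : T →+* k)).comp ρ').codRestrict (GLTwoDet D k) fun σ => by
      rw [← hfull'.map_eq]
      exact ⟨_, ⟨σ, rfl⟩, rfl⟩
  have he₀ : ∀ σ, (e₀ σ : GL (Fin 2) k) = Matrix.GeneralLinearGroup.map (π : T →+* k) (ρ' σ) :=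
    fun σ => rfl
  have he₀surj : Function.Surjective e₀ := by
    rintro ⟨γ, hγ⟩
    have hγ' := hγ
    rw [← hfull'.map_eq] at hγ'
    obtain ⟨_, ⟨σ, rfl⟩, h⟩ := hγ'
    exact ⟨σ, Subtype.ext h⟩
  have he₀ρ : ∀ σ, Matrix.GeneralLinearGroup.map
      (algebraMap k (IsLocalRing.ResidueField T)) (e₀ σ : GL (Fin 2) k) = ρbar σ := by
    intro σ
    have h1 : Matrix.GeneralLinearGroup.map (π : T →+* k) (ρ' σ) =
        Matrix.GeneralLinearGroup.map (π : T →+* k) (ρ σ) := by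
      change Matrix.GeneralLinearGroup.map (π : T →+* k) (u * ρ σ * u⁻¹) = _
      rw [map_mul, map_mul, map_inv, hu, one_mul, inv_one, mul_one]
    rw [he₀, h1, hρbar]
    ext i j
    exact hπres _
  have he₀ker : e₀.ker = ρbar.ker := by
    ext σ
    rw [MonoidHom.mem_ker, MonoidHom.mem_ker, ← he₀ρ]
    constructor
    · intro h
      rw [h, OneMemClass.coe_one, map_one]
    · intro h
      refine Subtype.ext (Units.ext (Matrix.ext fun i j => hres.1 ?_))
      have := congrArg (fun x : GL (Fin 2) (IsLocalRing.ResidueField T) => x i j) h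
      refine Eq.trans this ?_
      change (1 : Matrix (Fin 2) (Fin 2) (IsLocalRing.ResidueField T)) i j =
        algebraMap k _ ((1 : Matrix (Fin 2) (Fin 2) k) i j)
      rw [Matrix.one_apply, Matrix.one_apply]
      split_ifs <;> simp
  have hkeropen : IsOpen (ρ.ker : Set Gal(AlgebraicClosure ℚ/ℚ)) := isOpen_ker_of_continuous hρ
  have hkerle : ρ.ker ≤ ρbar.ker := by
    intro σ hσ
    rw [MonoidHom.mem_ker] at hσ ⊢
    rw [hρbar, MonoidHom.comp_apply, hσ, map_one]
  -- the field `K`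
  have hbaropen : IsOpen (ρbar.ker : Set Gal(AlgebraicClosure ℚ/ℚ)) :=
    Subgroup.isOpen_mono hkerle hkeropen
  obtain ⟨K, hK, hKfin, hKgal⟩ := exists_intermediateField_of_isOpen ρbar.ker hbaropen
  obtain ⟨r, hr, hrσ, hrker⟩ := exists_restriction_base K
  obtain ⟨e, he⟩ := MulEquiv.exists_of_surjective_of_ker_eq hr he₀surj
    (hrker.trans (hK.trans he₀ker.symm))
  have he' : ∀ σ, e.toMonoidHom (r σ) = e₀ σ := he
  -- the module `M` and the cocycle
  let M := hfull'.kernelModule hπ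
  have hMle : M.toAddSubgroup ≤ (ConjSubmodule.traceZero D (RingHom.ker π)).toAddSubgroup :=
    hfull'.kernelModule_le hπ
  obtain ⟨a, ha_mul, ha_eq⟩ := hfull'.exists_cocycle hπ huΓ e₀ he₀
  have ha_coc : ∀ σ τ, a (σ * τ) = a σ + e.toMonoidHom (r σ) • a τ := fun σ τ => by
    rw [he', ha_mul]
  have ha_zero : ∀ σ, r σ = 1 → ((ρ' σ : Matrix (Fin 2) (Fin 2) T) = 1 + (a σ).1) := by
    intro σ hσ
    rw [ha_eq, ← he', hσ, map_one]
    change _ * (algebraMap k T).mapMatrix 1 = _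
    rw [map_one, mul_one]
  have ha_surj : ∀ x : M.Elem, ∃ σ, r σ = 1 ∧ a σ = x := by
    rintro ⟨A, hA⟩
    obtain ⟨g, ⟨σ, rfl⟩, hσ⟩ := mem_matricesOf.1 hA.2
    have hσ1 : r σ = 1 := by
      rw [← MonoidHom.mem_ker, hrker, hK, ← he₀ker, MonoidHom.mem_ker]
      refine Subtype.ext (Units.ext (Matrix.ext fun i j => ?_))
      change π ((ρ' σ : Matrix (Fin 2) (Fin 2) T) i j) = (1 : Matrix (Fin 2) (Fin 2) k) i j
      rw [hσ, Matrix.add_apply, map_add, hA.1, add_zero, Matrix.one_apply, Matrix.one_apply]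
      split_ifs <;> simp
    refine ⟨σ, hσ1, Subtype.ext ?_⟩
    have h1 := ha_zero σ hσ1
    rw [hσ] at h1
    exact (add_left_cancel h1).symm
  have ha_ker : (cocycleHom r e.toMonoidHom a ha_coc).ker = ρ.ker := by
    ext σ
    rw [mem_ker_cocycleHom, ← hρ'ker, MonoidHom.mem_ker]
    constructor
    · rintro ⟨h1, h2⟩
      refine Units.ext ?_
      rw [ha_zero σ h1, h2]
      exact add_zero _
    · intro h
      have h1 : r σ = 1 := by
        rw [← MonoidHom.mem_ker, hrker, hK]
        exact hkerle (hρ'ker ▸ MonoidHom.mem_ker.2 h)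
      refine ⟨h1, Subtype.ext ?_⟩
      have h2 := ha_zero σ h1
      rw [h, Units.val_one] at h2
      exact left_eq_add.1 h2
  -- the field `L`
  obtain ⟨L, hLfix, hLfin, hLgal⟩ := exists_intermediateField_over_of_isOpen
    (cocycleHom r e.toMonoidHom a ha_coc).ker (by rw [ha_ker]; exact hkeropen) (cocycleHom_ker_le hrker ha_coc)
  have hKnf : NumberField K := { to_charZero := inferInstance, to_finiteDimensional := hKfin }
  have hLnf : NumberField L := { to_charZero := inferInstance, to_finiteDimensional := hLfin }
  have hLmod : GaloisModuleIso e.toMonoidHom L M.Elem :=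
    galoisModuleIso_of_cocycle hrσ hrker ha_coc ha_surj L hLfix
  obtain ⟨hLab, hLdeg⟩ := isAbelianGalois_of_galoisModuleIso hLmod
  -- the structure of `M`
  have : Nontrivial T := inferInstance
  obtain ⟨β, s, hs1, hs2, hs3⟩ := ConjSubmodule.exists_scalar_family hk2 (M := M)
  have hex := ConjSubmodule.exists_equiv hk2 hMle hs1 hs2 hs3
  obtain ⟨α, hα⟩ : ∃ α, α = Module.finrank k (M.offDiag hk2) := ⟨_, rfl⟩
  rw [← hα] at hex
  obtain ⟨f, hf⟩ := hex
  have hcard := ConjSubmodule.card_scalarPart hk2 hs1 hs2 hs3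
  have hm' : m = Module.finrank k (RingHom.ker π) := by rw [hm, hπker]
  refine ⟨α, β, ?_, ?_, ?_, K, L, hKnf, hLnf, hKgal, hLgal, hK, hLfix.trans ha_ker, e, ?_,
    ⟨M, ?_, ⟨f, hf⟩, semidirect_of_cocycle hrσ hr ha_coc ha_surj L hLfix, hLmod⟩, hLab, ?_, ?_, ?_⟩
  · rw [hm', hα]
    exact ConjSubmodule.finrank_offDiag_le hk2 hMle
  · rw [hm', hα]
    exact ConjSubmodule.complement_card_le hk2 hMle hd hcard
  · rw [hα, ht, ← ConjSubmodule.ncard_traces hk2 hMle hd hcard]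
    congr 1
    ext x
    have htr : ∀ σ, (ρ' σ : Matrix (Fin 2) (Fin 2) T).trace =
        (ρ σ : Matrix (Fin 2) (Fin 2) T).trace := by
      intro σ
      change ((u * ρ σ * u⁻¹ : GL (Fin 2) T) : Matrix (Fin 2) (Fin 2) T).trace = _
      rw [Units.val_mul, Units.val_mul, Matrix.trace_mul_comm, ← mul_assoc, Units.inv_mul, one_mul]
    constructor
    · rintro ⟨σ, rfl⟩
      refine ⟨(a σ).1, (a σ).2, _, (e₀ σ).2, ?_⟩
      rw [← ha_eq, htr]
    -- Both 1 + A and the constant matrix γ are values of ρ', hence so is their product.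
    · rintro ⟨A, hA, γ, hγ, rfl⟩
      obtain ⟨_, ⟨σ, rfl⟩, hσ⟩ := mem_matricesOf.1 hA.2
      obtain ⟨τ, hτ⟩ := huΓ γ hγ
      refine ⟨σ * τ, ?_⟩
      change (ρ (σ * τ) : Matrix (Fin 2) (Fin 2) T).trace = _
      rw [← htr, map_mul, Units.val_mul, hσ, hτ]
      rfl
  · intro σ κ hκ
    have h1 : r σ = κ := by
      ext x
      rw [hrσ]
      exact hκ x
    rw [← h1, he, he₀ρ]
  · rw [← hπker]
    exact hMle
  · rw [hLdeg, Nat.card_congr f.toEquiv, Nat.card_prod, Nat.card_fun, Nat.card_fun,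
      card_traceZero, card_scalarCTwo, hd, Nat.card_fin, Nat.card_fin, pow_add, ← pow_mul,
      ← pow_mul]
    ring
  · intro ℓ hℓ hℓN
    refine isUnramifiedExtAt_of_inertia_le hℓ.ne_zero fun 𝔓 h𝔓 hmem => ?_
    rw [hLfix, ha_ker]
    exact hunr ℓ hℓ hℓN 𝔓 h𝔓 hmem
  · intro hα0
    -- The components of the cocycle along the two summands of M are again surjective cocycles.
    -- Their kernels meet in G_L, which gives L₁L₂ = L.
    let a₁ : Gal(AlgebraicClosure ℚ/ℚ) → (Fin α → TraceZero D) := fun σ => (f (a σ)).1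
    let a₂ : Gal(AlgebraicClosure ℚ/ℚ) → (Fin β → ScalarCTwo D) := fun σ => (f (a σ)).2
    have ha₁ : ∀ σ τ, a₁ (σ * τ) = a₁ σ + e.toMonoidHom (r σ) • a₁ τ := fun σ τ => by
      simp only [a₁, ha_coc, map_add, hf]
      rfl
    have ha₂ : ∀ σ τ, a₂ (σ * τ) = a₂ σ + e.toMonoidHom (r σ) • a₂ τ := fun σ τ => by
      simp only [a₂, ha_coc, map_add, hf]
      rfl
    have hsurj₁ : ∀ x, ∃ σ, r σ = 1 ∧ a₁ σ = x := fun x => by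
      obtain ⟨σ, hσ, h1⟩ := ha_surj (f.symm (x, 0))
      exact ⟨σ, hσ, by simp only [a₁]; rw [h1, f.apply_symm_apply]⟩
    have hsurj₂ : ∀ x, ∃ σ, r σ = 1 ∧ a₂ σ = x := fun x => by
      obtain ⟨σ, hσ, h1⟩ := ha_surj (f.symm (0, x))
      exact ⟨σ, hσ, by simp only [a₂]; rw [h1, f.apply_symm_apply]⟩
    have hker : (cocycleHom r e.toMonoidHom a₁ ha₁).ker ⊓ (cocycleHom r e.toMonoidHom a₂ ha₂).ker =
        (cocycleHom r e.toMonoidHom a ha_coc).ker := by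
      ext σ
      rw [Subgroup.mem_inf, mem_ker_cocycleHom, mem_ker_cocycleHom, mem_ker_cocycleHom]
      constructor
      · rintro ⟨⟨h1, h2⟩, -, h3⟩
        exact ⟨h1, f.map_eq_zero_iff.1 (Prod.ext h2 h3)⟩
      · rintro ⟨h1, h2⟩
        have h3 : f (a σ) = 0 := f.map_eq_zero_iff.2 h2
        exact ⟨⟨h1, congrArg Prod.fst h3⟩, h1, congrArg Prod.snd h3⟩
    have hle₁ : ρ.ker ≤ (cocycleHom r e.toMonoidHom a₁ ha₁).ker := by
      rw [← ha_ker, ← hker]; exact inf_le_left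
    have hle₂ : ρ.ker ≤ (cocycleHom r e.toMonoidHom a₂ ha₂).ker := by
      rw [← ha_ker, ← hker]; exact inf_le_right
    obtain ⟨L₁, hL₁, -, hL₁gal⟩ := exists_intermediateField_over_of_isOpen _
      (Subgroup.isOpen_mono hle₁ hkeropen) (cocycleHom_ker_le hrker ha₁)
    obtain ⟨L₂, hL₂, -, hL₂gal⟩ := exists_intermediateField_over_of_isOpen _
      (Subgroup.isOpen_mono hle₂ hkeropen) (cocycleHom_ker_le hrker ha₂)
    obtain ⟨g, x, hgx⟩ := exists_smul_ne_traceZero D hα0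
    refine ⟨L₁, L₂, hL₁gal, hL₂gal, ?_,
      galoisModuleIso_of_cocycle hrσ hrker ha₁ hsurj₁ L₁ hL₁,
      not_isDefinableOverRat_of_cocycle hr hrker (by rw [hK]; exact hbaropen) ha₁ hsurj₁ L₁ hL₁
        (κ := e.symm g) (x := x) ?_,
      galoisModuleIso_of_cocycle hrσ hrker ha₂ hsurj₂ L₂ hL₂⟩
    · exact sup_eq_of_fixingSubgroup (by rw [hL₁, hL₂, hLfix, hker])
    · change e (e.symm g) • x ≠ x
      rwa [e.apply_symm_apply]
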